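/- **Setting.** On $\mathbb R^4=\mathbb R_t\times\mathbb R^3_x$ put $x^0=t$, $r=|x|$, $q=r-t$, $\omega_i=x_i/r$, $m=\mathrm{diag}(-1,1,1,1)$, $x_\alpha=m_{\alpha\beta}x^\beta$. Let $\mathfrak L$ be the family of the eleven vector fields $\partial_\alpha$ $(0\le\alpha\le3)$, $\Omega_{\alpha\beta}=-x_\alpha\partial_\beta+x_\beta\partial_\alpha$ $(0\le\alpha<\beta\le 3)$, $t\partial_t+r\partial_r$; for a multi-index $I$ of length $|I|=k$ let $Z^I$ be the corresponding product of $k$ fields of $\mathfrak L$, acting on tensors componentwise in the coordinates $x^\alpha$. Let $\bar\partial_0=\partial_t+\partial_r$ and $\bar\partial_i=\partial_i-\omega_i\partial_r$ $(i=1,2,3)$ for $x\neq0$. For a tensor field $p$, $|p|$, $|\partial p|$, $|\bar\partial p|$ are the Euclidean norms of the arrays of all components of $p$, $\partial_\alpha p$, $\bar\partial_\alpha p$. Fix an integer $N\ge4$ and $\gamma,\mu\in(0,1/2)$, let $w(q)=1+(1+|q|)^{1+2\gamma}$ for $q>0$, $w(q)=1+(1+|q|)^{-2\mu}$ for $q<0$,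 and $$\mathcal E_N(t)=\sum_{|I|\le N}\Big(\|\sqrt w\,\partial Z^Ih(\cdot,t)\|_{L^2(\mathbb R^3)}+\|\sqrt w\,\partial Z^IA(\cdot,t)\|_{L^2(\mathbb R^3)}\Big).$$ Let $0<T<\infty$. Let $h$ be a 2-tensor field and $A$ a 1-form on $(-T,T)\times\mathbb R^3$ (for instance $h=g-m$ and $A$ for a solution $(g,A)$ of the Einstein–Maxwell equations) which are continuous, whose first derivatives lie in $\bigcap_{k=0}^{N}C^{N-k}\big((-T,T),H_k(\mathbb R^3)\big)$, and for which $h(\cdot,0)$ and $A(\cdot,0)$ tend to $0$ at spatial infinity. The derivatives in $\mathcal E_N$ are generalized derivatives. **Theorem.** For all $N,\gamma,\mu,T$ as above and every $C>0$ there is a constant $K$, depending only on $N,\gamma,\mu,T,C$, such that for every $\varepsilon>0$, every $T_0\le T$ and all $h,A$ as above satisfying $$\mathcal E_N(t)\le 2C\varepsilon\qquad\text{for all }t\in[0,T_0),$$ the components of $h$ and $A$ are of class $C^{N-1}$ on $(-T,T)\times\mathbb R^3$, and for all $t\in[0,T_0)$, $x\in\mathbb R^3$: $$|\partial Z^Ih|+|\partial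 Z^IA|\le\begin{cases}K\varepsilon(1+t+|q|)^{-1}(1+|q|)^{-1-\gamma},&q>0,\\K\varepsilon(1+t+|q|)^{-1}(1+|q|)^{-1/2},&q<0,\end{cases}\qquad|I|\le N-3,$$ $$|Z^Ih|+|Z^IA|\le\begin{cases}K\varepsilon(1+t+|q|)^{-1}(1+|q|)^{-\gamma},&q>0,\\K\varepsilon(1+t+|q|)^{-1}(1+|q|)^{1/2},&q<0,\end{cases}\qquad|I|\le N-3,$$ $$|\bar\partial Z^Ih|+|\bar\partial Z^IA|\le\begin{cases}K\varepsilon(1+t+|q|)^{-2}(1+|q|)^{-\gamma},&q>0,\\K\varepsilon(1+t+|q|)^{-2}(1+|q|)^{1/2},&q<0,\end{cases}\qquad|I|\le N-4,\ x\ne0,$$ and also, in the restated form, $$|\partial Z^Ih|+|\partial Z^IA|\le\begin{cases}K\varepsilon(1+|q|)^{-2-\gamma},&q>0,\\K\varepsilon(1+|q|)^{-3/2},&q<0,\end{cases}\qquad|I|\le N-3,$$ $$|Z^Ih|+|Z^IA|\le\begin{cases}K\varepsilon(1+|q|)^{-1-\gamma},&q>0,\\K\varepsilon(1+|q|)^{-1/2},&q<0,\end{cases}\qquad|I|\le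 N-3,$$ $$|\bar\partial Z^Ih|+|\bar\partial Z^IA|\le\begin{cases}K\varepsilon(1+|q|)^{-2-\gamma},&q>0,\\K\varepsilon(1+|q|)^{-3/2},&q<0,\end{cases}\qquad|I|\le N-4,\ x\ne0.$$ -/

import Mathlib

open MeasureTheory Filter Topology
open scoped ENNReal ContDiff

namespace EinsteinMaxwell

noncomputable section

/-- The space slice `ℝ³` with its Euclidean structure. -/
abbrev Space : Type := EuclideanSpace ℝ (Fin 3)

/-- Points `(t, x)` of `ℝ⁴ = ℝ × ℝ³`. -/
abbrev Spacetime : Type := ℝ × Space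

/-- The coordinates `x⁰ = t, x¹, x², x³`. -/
def coord (α : Fin 4) (p : Spacetime) : ℝ :=
  Fin.cases (motive := fun _ => ℝ) p.1 (fun i => p.2 i) α

/-- The coordinate frame: `frame 0 = ∂_t`, `frame i = ∂_{xⁱ}`. -/
def frame (α : Fin 4) : Spacetime :=
  Fin.cases (motive := fun _ => Spacetime) (1, 0) (fun i => (0, EuclideanSpace.single i 1)) α

/-- The diagonal entries of the Minkowski metric `m = diag(-1, 1, 1, 1)`. -/
def mink (α : Fin 4) : ℝ := if α = 0 then -1 else 1

/-- The open slab `V_T = (-T, T) × ℝ³`. -/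
def slab (T : ℝ) : Set Spacetime := {p | p.1 ∈ Set.Ioo (-T) T}

/-- The variable `q = |x| - t`. -/
def qvar (p : Spacetime) : ℝ := ‖p.2‖ - p.1

/-- The weight `w(q)`. Both branches take the value `2` at `q = 0`. -/
def weight (γ μ q : ℝ) : ℝ :=
  if 0 < q then 1 + (1 + |q|) ^ (1 + 2 * γ) else 1 + (1 + |q|) ^ (-2 * μ)

/-! ### The eleven vector fields -/

/-- Labels of the family of vector fields: the four translations `∂_α`, the six
`Ω_{αβ} = -x_α ∂_β + x_β ∂_α` with `α < β`, and the scaling field `t ∂_t + r ∂_r`. -/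
abbrev ZField : Type := Fin 4 ⊕ ({s : Fin 4 × Fin 4 // s.1 < s.2} ⊕ Unit)

/-- Action of the eleven vector fields on a space `M` of objects on which the partial derivatives
`D α = ∂_α` and the multiplications `X α` by the coordinates `x^α` act. Indices are lowered with the
Minkowski metric, so `x_α = mink α * x^α`; and `t ∂_t + r ∂_r = ∑_α x^α ∂_α`. -/
def applyZ {M : Type*} [AddCommGroup M] [Module ℝ M] (D X : Fin 4 → M → M) : ZField → M → M
  | Sum.inl α => fun u => D α u
  | Sum.inr (Sum.inl s) => fun u =>
      -(mink s.1.1 • X s.1.1 (D s.1.2 u)) + mink s.1.2 • X s.1.2 (D s.1.1 u)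
  | Sum.inr (Sum.inr _) => fun u => ∑ α, X α (D α u)

/-- `Z^I = Z^{ι₁} ⋯ Z^{ι_k}` for `I = [ι₁, …, ι_k]`. -/
def iterZ {M : Type*} [AddCommGroup M] [Module ℝ M] (D X : Fin 4 → M → M)
    (I : List ZField) (u : M) : M :=
  I.foldr (applyZ D X) u

/-! ### Classical derivatives -/

/-- The classical partial derivative `∂_α f`. -/
def pd (α : Fin 4) (f : Spacetime → ℝ) : Spacetime → ℝ := fun p => fderiv ℝ f p (frame α)

/-- Multiplication by the coordinate `x^α`. -/
def mulCoord (α : Fin 4) (f : Spacetime → ℝ) : Spacetime → ℝ := fun p => coord α p * f p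

/-- `Z^I f` with classical derivatives. -/
def Zc (I : List ZField) (f : Spacetime → ℝ) : Spacetime → ℝ := iterZ pd mulCoord I f

/-- `ω_i = x_i / r`. -/
def omega (i : Fin 3) (p : Spacetime) : ℝ := p.2 i / ‖p.2‖

/-- The radial derivative `∂_r = ω_i ∂_i`. -/
def radial (f : Spacetime → ℝ) : Spacetime → ℝ := fun p => ∑ i, omega i p * pd i.succ f p

/-- The tangential derivatives `∂̄_0 = L = ∂_t + ∂_r`, `∂̄_i = ∂_i - ω_i ∂_r` (for `x ≠ 0`). -/
def tang (β : Fin 4) (f : Spacetime → ℝ) : Spacetime → ℝ := fun p =>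
  Fin.cases (motive := fun _ => ℝ) (pd 0 f p + radial f p)
    (fun i => pd i.succ f p - omega i p * radial f p) β

/-! Tensor fields are given by their components in the coordinates `x^α`; `κ` is the type of
component indices (`Fin 4 × Fin 4` for the 2-tensor `h`, `Fin 4` for the 1-form `A`), vector fields
act on components, and the norm is the Euclidean norm of the array of components. -/

section Norms
variable {κ : Type} [Fintype κ]

/-- `|Z^I u|(p)`. -/
def normZ (I : List ZField) (u : κ → Spacetime → ℝ) (p : Spacetime) : ℝ :=
  √(∑ c, (Zc I (u c) p) ^ 2)

/-- `|∂ Z^I u|(p)`. -/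
def normDZ (I : List ZField) (u : κ → Spacetime → ℝ) (p : Spacetime) : ℝ :=
  √(∑ c, ∑ α, (pd α (Zc I (u c)) p) ^ 2)

/-- `|∂̄ Z^I u|(p)`. -/
def normTangZ (I : List ZField) (u : κ → Spacetime → ℝ) (p : Spacetime) : ℝ :=
  √(∑ c, ∑ β, (tang β (Zc I (u c)) p) ^ 2)

end Norms

/-! ### Generalized derivatives -/

/-- A family indexed by lists of coordinate directions. The jet of a function `u` is the family
of its generalized derivatives `J [α₁, …, α_k] = ∂_{α₁} ⋯ ∂_{α_k} u`. -/
abbrev Jet : Type := List (Fin 4) → Spacetime → ℝ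

/-- If `J` is the jet of `u`, this is the jet of `∂_α u`. -/
def jetD (α : Fin 4) (J : Jet) : Jet := fun a => J (a ++ [α])

/-- If `J` is the jet of `u`, this is the jet of `x^β u`, by the Leibniz rule
`∂^a (x^β u) = x^β ∂^a u + ∑_{k : a_k = β} ∂^{a without its k-th entry} u`. -/
def jetX (β : Fin 4) (J : Jet) : Jet := fun a p =>
  coord β p * J a p + ∑ k : Fin a.length, if a.get k = β then J (a.eraseIdx k) p else 0

/-- If `J` is the jet of `u`, this is the jet of `Z^I u`. -/
def jetZ (I : List ZField) (J : Jet) : Jet := iterZ jetD jetX I J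

/-- `u` is a continuous function on `V_T` whose first derivatives `∂_t u, ∂_i u` lie in
`⋂_{k ≤ s-1} C^{s-1-k}((-T, T), H_k(ℝ³))`, and `J` is the family of its generalized derivatives up
to order `s`. That is, all derivatives of order `1, …, s` are continuous functions of time with
values in `L²(ℝ³)`, space derivatives being weak derivatives on the time slices and time derivatives
being derivatives of `L²(ℝ³)`-valued functions of time. -/
structure IsSobolevJet (s : ℕ) (T : ℝ) (u : Spacetime → ℝ) (J : Jet) : Prop where
  zeroth : J [] = u
  continuousOn : ContinuousOn u (slab T)
  memLp : ∀ a : List (Fin 4), a ≠ [] → a.length ≤ s → ∀ t ∈ Set.Ioo (-T) T,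
    MemLp (fun x : Space => J a (t, x)) 2 volume
  continuous_time : ∀ a : List (Fin 4), a ≠ [] → a.length ≤ s → ∀ t ∈ Set.Ioo (-T) T,
    Tendsto (fun τ => eLpNorm (fun x : Space => J a (τ, x) - J a (t, x)) 2 volume) (𝓝 t) (𝓝 0)
  space_deriv : ∀ a : List (Fin 4), a.length < s → ∀ t ∈ Set.Ioo (-T) T, ∀ i : Fin 3,
    ∀ φ : Space → ℝ, ContDiff ℝ ∞ φ → HasCompactSupport φ →
      ∫ x, J a (t, x) * fderiv ℝ φ x (EuclideanSpace.single i 1)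
        = -∫ x, J (i.succ :: a) (t, x) * φ x
  time_deriv : ∀ a : List (Fin 4), a.length < s → ∀ t ∈ Set.Ioo (-T) T,
    Tendsto (fun τ => eLpNorm (fun x : Space =>
      (τ - t)⁻¹ * (J a (τ, x) - J a (t, x)) - J (0 :: a) (t, x)) 2 volume) (𝓝[≠] t) (𝓝 0)

section Energy
variable {κ : Type} [Fintype κ]

/-- `‖√w ∂ Z^I u(·, t)‖_{L²(ℝ³)}`, where `J c` is the jet of the component `u c`. -/
def energyTerm (γ μ : ℝ) (I : List ZField) (J : κ → Jet) (t : ℝ) : ℝ≥0∞ :=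
  eLpNorm (fun x : Space =>
    √(weight γ μ (qvar (t, x))) * √(∑ c, ∑ α, (jetD α (jetZ I (J c)) [] (t, x)) ^ 2)) 2 volume

end Energy

/-- The energy `𝓔_N(t)` (the value `∞` is allowed): the sum over all multi-indices of length
at most `N`, where `Jh`, `JA` are the jets of the components of `h` and `A`. -/
def energy (N : ℕ) (γ μ : ℝ) (Jh : Fin 4 × Fin 4 → Jet) (JA : Fin 4 → Jet) (t : ℝ) : ℝ≥0∞ :=
  ∑ k ∈ Finset.range (N + 1), ∑ I : Fin k → ZField,
    (energyTerm γ μ (List.ofFn I) Jh t + energyTerm γ μ (List.ofFn I) JA t)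

end

end EinsteinMaxwell

open EinsteinMaxwell

/-!
# Pointwise decay from the weighted energy

The height `T` of the slab is finite, and this makes the estimates local in time. For `0 ≤ t < T`
the quantities `1 + t + |q|` and `1 + |x|` are comparable, the region `q < 0` is bounded in space,
and the weight satisfies `w(q) ≥ ((1 + |x|) / (1 + T)) ^ (1 + 2γ)` (`rpow_le_weight`). Hence all six
estimates follow from decay in `1 + |x|` (`le_decay_of_le_rpow`): the rate `-2 - γ` for `∂Z^I` and
`∂̄Z^I`, and the rate `-1 - γ` for `Z^I` (`exists_component_decay`).

*Regularity.* A jet of generalized derivatives is mollified in the space variables only. The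
mollified jets are classical (`IsSobolevJet.isClassicalJet_mollJet`), because convolution with a
test function turns `L²`-valued differentiability in time into pointwise differentiability. The
embedding `H² ⊂ L^∞` on the slices makes their entries of order at most `N - 1` converge locally
uniformly, so that the limit `V` is a classical jet of order `N - 1` with `V [] = u`
(`IsSobolevJet.exists_isClassicalJet`). In particular `u` is of class `C^{N-1}`, and classical and
generalized `Z^I u` agree.

*Decay of derivatives.* The Sobolev inequality on the ball of radius `ρ = (1 + |x|) / 4` around `x`
bounds `|f(x)|` by `ρ ^ (-3/2)` times the `L²` norm of `|f| + ρ|∇f| + ρ²|∇²f|`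
(`exists_sobolev_const`). Since `t` is bounded, `(1 + |x|) ∂_α` is a combination of the fields of
the family with bounded coefficients (`one_add_norm_mul_abs_le`), and the fields obey commutation
relations with the `∂_α` whose coefficients are constant (`abs_applyZ_jetD_sub_le`). For
`f = ∂Z^I u` the integrand is thus bounded by `∂Z^L u` with `|L| ≤ |I| + 2 ≤ N`
(`exists_klainerman_sobolev_const`). The weight gains another factor `ρ ^ (-1/2 - γ)`
(`exists_abs_jetZ_le`). These inequalities are applied to the mollified jets, whose norms on balls
converge to those of the given jet.

*Decay of the fields.* If `I` is not empty, `Z^I u` is at most `1 + |x|` times the derivatives of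
some `Z^{I'} u` (`abs_applyZ_le`). For `u` itself the bound on `∂_t u` carries the vanishing at
spatial infinity from time `0` to time `t` (`IsClassicalJet.tendsto_cocompact`), and the bound on
the spatial derivatives is integrated inwards along the ray through `x`
(`IsClassicalJet.abs_nil_le`).
-/

namespace EinsteinMaxwell

/-! ### Algebra of jets -/

/-- At the point `p` the entries of `J` of order at most `m` do not depend on the order of the
differentiations. -/
def SymmAt (m : ℕ) (p : Spacetime) (J : Jet) : Prop :=
  ∀ a b : List (Fin 4), a.Perm b → a.length ≤ m → J a p = J b p

lemma SymmAt.mono {m n : ℕ} {p : Spacetime} {J : Jet} (h : SymmAt n p J) (hmn : m ≤ n) :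
    SymmAt m p J := fun a b hab ha => h a b hab (ha.trans hmn)

lemma jetX_nil (β : Fin 4) (J : Jet) (p : Spacetime) :
    jetX β J [] p = coord β p * J [] p := by
  simp [jetX]

/-- The Leibniz rule `∂_α ∂^a (x^β u) = ∂^a (x^β ∂_α u) + δ_{αβ} ∂^a u`, for the outermost
derivative. -/
lemma jetX_cons (β α : Fin 4) (J : Jet) (a : List (Fin 4)) (p : Spacetime) :
    jetX β J (α :: a) p = jetX β (fun b => J (α :: b)) a p + if α = β then J a p else 0 := by
  simp only [jetX]
  rw [add_assoc, add_right_inj, add_comm]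
  exact Fin.sum_univ_succ (n := a.length)
    (fun k => if (α :: a).get k = β then J ((α :: a).eraseIdx k) p else 0)

/-- The Leibniz rule of `jetX_cons`, for the innermost derivative. -/
lemma jetX_concat (β α : Fin 4) (J : Jet) (a : List (Fin 4)) (p : Spacetime) :
    jetX β J (a ++ [α]) p = jetX β (jetD α J) a p + if α = β then J a p else 0 := by
  induction a generalizing J with
  | nil => rw [List.nil_append, jetX_cons, jetX_nil, jetX_nil]; rfl
  | cons x a ih =>
    rw [List.cons_append, jetX_cons, ih, jetX_cons]
    have e : (fun b => jetD α J (x :: b)) = jetD α fun b => J (x :: b) := rfl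
    rw [e]
    simp only [jetD]
    ring

lemma jetX_congr {β : Fin 4} {J J' : Jet} {a : List (Fin 4)} {p : Spacetime}
    (h : ∀ b : List (Fin 4), b.length ≤ a.length → J b p = J' b p) :
    jetX β J a p = jetX β J' a p := by
  simp only [jetX]
  rw [h a le_rfl]
  congr 1
  refine Finset.sum_congr rfl fun k _ => ?_
  rw [h _ (List.length_eraseIdx_le a k)]

lemma SymmAt.jetD {m : ℕ} {p : Spacetime} {J : Jet} (h : SymmAt (m + 1) p J) (α : Fin 4) :
    SymmAt m p (jetD α J) := fun a b hab ha =>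
  h _ _ (hab.append_right _) (by simpa using ha)

lemma SymmAt.jetX {m : ℕ} {p : Spacetime} {J : Jet} (h : SymmAt m p J) (β : Fin 4) :
    SymmAt m p (jetX β J) := by
  intro a b hab
  induction hab generalizing J m with
  | nil => intro _; rfl
  | @cons x a b hab ih =>
    intro ha
    rw [jetX_cons, jetX_cons]
    obtain ⟨m, rfl⟩ : ∃ k, m = k + 1 := ⟨m - 1, by simp at ha; omega⟩
    have ha' : a.length ≤ m := by simpa using ha
    rw [ih (m := m) (J := fun b => J (x :: b))
      (fun c d hcd hc => h _ _ (hcd.cons x) (by simpa using hc)) ha',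
      h a b hab (by omega)]
  | swap x y l =>
    intro ha
    have ha' : l.length + 2 ≤ m := by simp only [List.length_cons] at ha; omega
    simp only [jetX_cons]
    rw [jetX_congr (J' := fun b => J (x :: y :: b))]
    · ring
    · intro b hb
      exact h _ _ (List.Perm.swap _ _ _) (by simp; omega)
  | trans hab _ ih₁ ih₂ =>
    intro ha
    rw [ih₁ h ha, ih₂ h (by rwa [← hab.length_eq])]

lemma SymmAt.neg_add {m : ℕ} {p : Spacetime} {J J' : Jet} (h : SymmAt m p J)
    (h' : SymmAt m p J') (c c' : ℝ) : SymmAt m p (-(c • J) + c' • J') := fun a b hab ha => by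
  simp [h a b hab ha, h' a b hab ha]

lemma SymmAt.applyZ {m : ℕ} {p : Spacetime} {J : Jet} (h : SymmAt (m + 1) p J) (Z : ZField) :
    SymmAt m p (applyZ EinsteinMaxwell.jetD EinsteinMaxwell.jetX Z J) := by
  rcases Z with α | s | _
  · exact h.jetD α
  · exact ((h.jetD _).jetX _).neg_add ((h.jetD _).jetX _) _ _
  · intro a b hab ha
    simp only [EinsteinMaxwell.applyZ, Finset.sum_apply]
    exact Finset.sum_congr rfl fun α _ => (h.jetD α).jetX α a b hab ha

lemma jetX_jetD_concat {m : ℕ} {p : Spacetime} {J : Jet} (h : SymmAt m p J) (β γ α : Fin 4)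
    (a : List (Fin 4)) (ha : a.length + 2 ≤ m) :
    jetX β (jetD γ J) (a ++ [α]) p
      = jetX β (jetD γ (jetD α J)) a p + if α = β then J (a ++ [γ]) p else 0 := by
  rw [jetX_concat]
  congr 1
  refine jetX_congr fun b hb => ?_
  refine h _ _ ?_ (by simp; omega)
  rw [List.append_assoc, List.append_assoc]
  exact (List.Perm.swap _ _ _).append_left b

/-- The commutator of a field of the family with `∂_α` is a constant multiple of a translation, for
formal derivatives as soon as they commute. -/
lemma abs_applyZ_jetD_sub_le {m : ℕ} {p : Spacetime} {J : Jet} (h : SymmAt m p J) (Z : ZField)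
    (α : Fin 4) (a : List (Fin 4)) (ha : a.length + 2 ≤ m) :
    |applyZ jetD jetX Z (jetD α J) a p - applyZ jetD jetX Z J (a ++ [α]) p|
      ≤ 2 * ∑ β, |J (a ++ [β]) p| := by
  have hle : ∀ γ, |J (a ++ [γ]) p| ≤ ∑ β, |J (a ++ [β]) p| := fun γ =>
    Finset.single_le_sum (f := fun β => |J (a ++ [β]) p|) (fun _ _ => abs_nonneg _)
      (Finset.mem_univ γ)
  have h0 : 0 ≤ ∑ β, |J (a ++ [β]) p| := Finset.sum_nonneg fun _ _ => abs_nonneg _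
  have hm : ∀ γ, |mink γ| = 1 := by intro γ; unfold mink; split_ifs <;> simp
  rcases Z with γ | ⟨⟨γ, δ⟩, hs⟩ | _
  · have : jetD γ (jetD α J) a p = jetD γ J (a ++ [α]) p := by
      refine h _ _ ?_ (by simp; omega)
      rw [List.append_assoc, List.append_assoc]
      exact (List.Perm.swap _ _ _).append_left a
    simp only [applyZ, this, sub_self, abs_zero]
    positivity
  · simp only [applyZ, Pi.add_apply, Pi.neg_apply, Pi.smul_apply, smul_eq_mul]
    rw [jetX_jetD_concat h _ _ _ _ ha, jetX_jetD_concat h _ _ _ _ ha]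
    have e : ∀ x y u v c d : ℝ, -(c * x) + d * y - (-(c * (x + u)) + d * (y + v))
      = c * u - d * v := by intros; ring
    rw [e]
    have key : ∀ γ δ : Fin 4, |mink γ * (if α = γ then J (a ++ [δ]) p else 0)|
        ≤ ∑ β, |J (a ++ [β]) p| := by
      intro γ δ
      rw [abs_mul, hm, one_mul]
      split_ifs
      · exact hle δ
      · simpa using h0
    exact (abs_sub _ _).trans (by linarith [key γ δ, key δ γ])
  · simp only [applyZ, Finset.sum_apply]
    rw [Finset.sum_congr rfl fun β _ => jetX_jetD_concat h β β α a ha, Finset.sum_add_distrib,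
      sub_add_cancel_left, abs_neg]
    simp only [Finset.sum_ite_eq, Finset.mem_univ, if_true]
    linarith [hle α]

/-! ### Gain of decay from the vector fields on a slab of finite height -/

lemma coord_zero (p : Spacetime) : coord 0 p = p.1 := rfl

lemma coord_succ (i : Fin 3) (p : Spacetime) : coord i.succ p = p.2 i := rfl

lemma mink_zero : mink 0 = -1 := rfl

lemma mink_succ (i : Fin 3) : mink i.succ = 1 := by simp [mink]

/-- Since `t` is bounded, every coordinate derivative gains a factor `1 + |x|` in terms of the
fields of the family: `(1 + |x|²) ∂_i = ∂_i + x_i (S - t ∂_t) + ∑_j x_j (x_j ∂_i - x_i ∂_j)` and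
`(1 + |x|²) ∂_t = ∂_t + ∑_i x_i (x_i ∂_t + t ∂_i) - t ∑_i x_i ∂_i`. -/
lemma one_add_norm_mul_abs_le {T : ℝ} {p : Spacetime} (hp : |p.1| ≤ T) (J : Jet) (α : Fin 4) :
    (1 + ‖p.2‖) * |J [α] p| ≤ (8 + 6 * T) * ∑ Z, |applyZ jetD jetX Z J [] p| := by
  have hT : 0 ≤ T := (abs_nonneg _).trans hp
  set M := ∑ Z, |applyZ jetD jetX Z J [] p| with hM
  have hle : ∀ Z, |applyZ jetD jetX Z J [] p| ≤ M := fun Z =>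
    Finset.single_le_sum (f := fun Z => |applyZ jetD jetX Z J [] p|) (fun _ _ => abs_nonneg _)
      (Finset.mem_univ Z)
  have hd : ∀ γ, |J [γ] p| ≤ M := fun γ => hle (Sum.inl γ)
  have hS : |p.1 * J [0] p + ∑ i : Fin 3, p.2 i * J [i.succ] p| ≤ M := by
    have := hle (Sum.inr (Sum.inr ()))
    simpa only [applyZ, Finset.sum_apply, jetX_nil, Fin.sum_univ_succ (n := 3), coord_zero,
      coord_succ, jetD, List.nil_append] using this
  have hB : ∀ i : Fin 3, |p.1 * J [i.succ] p + p.2 i * J [0] p| ≤ M := by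
    intro i
    have := hle (Sum.inr (Sum.inl ⟨(0, i.succ), Fin.succ_pos i⟩))
    simp only [applyZ, Pi.add_apply, Pi.neg_apply, Pi.smul_apply, smul_eq_mul, jetX_nil,
      coord_zero, coord_succ, mink_zero, mink_succ, jetD, List.nil_append] at this
    simpa using this
  have hR' : ∀ i j : Fin 3, i < j → |p.2 i * J [j.succ] p - p.2 j * J [i.succ] p| ≤ M := by
    intro i j hij
    have := hle (Sum.inr (Sum.inl ⟨(i.succ, j.succ), Fin.succ_lt_succ_iff.2 hij⟩))
    simp only [applyZ, Pi.add_apply, Pi.neg_apply, Pi.smul_apply, smul_eq_mul, jetX_nil,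
      coord_succ, mink_succ, jetD, List.nil_append, one_mul] at this
    rw [abs_sub_comm]
    convert this using 2
    ring
  have hM0 : 0 ≤ M := (abs_nonneg _).trans (hd 0)
  have hR : ∀ i j : Fin 3, |p.2 j * J [i.succ] p - p.2 i * J [j.succ] p| ≤ M := by
    intro i j
    rcases lt_trichotomy i j with hij | rfl | hij
    · rw [abs_sub_comm]; exact hR' i j hij
    · simpa using hM0
    · exact hR' j i hij
  set r := ‖p.2‖ with hr
  have hr0 : 0 ≤ r := norm_nonneg _
  have hr2 : r ^ 2 = ∑ i, p.2 i * p.2 i := by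
    rw [hr, EuclideanSpace.real_norm_sq_eq]; simp [sq]
  have hx : ∀ i, |p.2 i| ≤ r := fun i => PiLp.norm_apply_le p.2 i
  have key : (1 + r ^ 2) * |J [α] p| ≤ M + (4 + 3 * T) * r * M := by
    rw [← abs_of_nonneg (a := 1 + r ^ 2) (by positivity), ← abs_mul]
    refine Fin.cases ?_ (fun i => ?_) α
    · have e : (1 + r ^ 2) * J [0] p = J [0] p
          + (∑ i : Fin 3, p.2 i * (p.1 * J [i.succ] p + p.2 i * J [0] p)
            - ∑ i : Fin 3, p.1 * (p.2 i * J [i.succ] p)) := by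
        rw [← Finset.sum_sub_distrib, hr2, add_mul, one_mul, Finset.sum_mul]
        congr 1
        exact Finset.sum_congr rfl fun i _ => by ring
      rw [e]
      have h1 : |∑ i : Fin 3, p.2 i * (p.1 * J [i.succ] p + p.2 i * J [0] p)| ≤ 3 * (r * M) := by
        refine (Finset.abs_sum_le_sum_abs _ _).trans ?_
        refine (Finset.sum_le_card_nsmul _ _ (r * M) fun i _ => ?_).trans (by simp)
        rw [abs_mul]
        exact mul_le_mul (hx i) (hB i) (abs_nonneg _) hr0
      have h2 : |∑ i : Fin 3, p.1 * (p.2 i * J [i.succ] p)| ≤ 3 * (T * (r * M)) := by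
        refine (Finset.abs_sum_le_sum_abs _ _).trans ?_
        refine (Finset.sum_le_card_nsmul _ _ (T * (r * M)) fun i _ => ?_).trans (by simp)
        rw [abs_mul, abs_mul]
        exact mul_le_mul hp (mul_le_mul (hx i) (hd _) (abs_nonneg _) hr0) (by positivity) hT
      have h3 := abs_add_le (J [0] p)
          (∑ i : Fin 3, p.2 i * (p.1 * J [i.succ] p + p.2 i * J [0] p)
            - ∑ i : Fin 3, p.1 * (p.2 i * J [i.succ] p))
      have h4 := abs_sub (∑ i : Fin 3, p.2 i * (p.1 * J [i.succ] p + p.2 i * J [0] p))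
            (∑ i : Fin 3, p.1 * (p.2 i * J [i.succ] p))
      have h5 := hd 0
      have h6 : 0 ≤ r * M := by positivity
      linarith
    · have e : (1 + r ^ 2) * J [i.succ] p = J [i.succ] p
          + (p.2 i * ((p.1 * J [0] p + ∑ j : Fin 3, p.2 j * J [j.succ] p) - p.1 * J [0] p)
            + ∑ j : Fin 3, p.2 j * (p.2 j * J [i.succ] p - p.2 i * J [j.succ] p)) := by
        rw [add_sub_cancel_left, Finset.mul_sum, ← Finset.sum_add_distrib, hr2, add_mul, one_mul,
          Finset.sum_mul]
        congr 1
        exact Finset.sum_congr rfl fun i _ => by ring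
      rw [e]
      have h1 : |∑ j : Fin 3, p.2 j * (p.2 j * J [i.succ] p - p.2 i * J [j.succ] p)|
          ≤ 3 * (r * M) := by
        refine (Finset.abs_sum_le_sum_abs _ _).trans ?_
        refine (Finset.sum_le_card_nsmul _ _ (r * M) fun j _ => ?_).trans (by simp)
        rw [abs_mul]
        exact mul_le_mul (hx j) (hR i j) (abs_nonneg _) hr0
      have h2 : |p.2 i * ((p.1 * J [0] p + ∑ j : Fin 3, p.2 j * J [j.succ] p) - p.1 * J [0] p)|
          ≤ r * (M + T * M) := by
        rw [abs_mul]
        refine mul_le_mul (hx i) ((abs_sub _ _).trans ?_) (abs_nonneg _) hr0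
        rw [abs_mul]
        exact add_le_add hS (mul_le_mul hp (hd 0) (abs_nonneg _) hT)
      have h3 := abs_add_le (J [i.succ] p)
        (p.2 i * ((p.1 * J [0] p + ∑ j : Fin 3, p.2 j * J [j.succ] p) - p.1 * J [0] p)
            + ∑ j : Fin 3, p.2 j * (p.2 j * J [i.succ] p - p.2 i * J [j.succ] p))
      have h4 := abs_add_le
        (p.2 i * ((p.1 * J [0] p + ∑ j : Fin 3, p.2 j * J [j.succ] p) - p.1 * J [0] p))
        (∑ j : Fin 3, p.2 j * (p.2 j * J [i.succ] p - p.2 i * J [j.succ] p))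
      have h5 := hd i.succ
      have h6 : 0 ≤ T * (r * M) := by positivity
      nlinarith
  have h0 := abs_nonneg (J [α] p)
  have h1 : (1 + r) * ((1 + r) * |J [α] p|) ≤ (1 + r) * ((8 + 6 * T) * M) := by
    have : 0 ≤ (1 - r) ^ 2 * |J [α] p| := by positivity
    have h7 : M ≤ (4 + 3 * T) * M := by nlinarith [mul_nonneg hT hM0]
    nlinarith
  exact le_of_mul_le_mul_left h1 (by positivity)

/-- The sum `∑_{|L| ≤ k} |∂ Z^L u|`, in terms of the jet of `u`; the terms with `|L| < k` are
counted with multiplicity. -/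
def sumDZ : ℕ → Jet → Spacetime → ℝ
  | 0, J, p => ∑ β, |J [β] p|
  | k + 1, J, p => sumDZ k J p + ∑ Z, sumDZ k (applyZ jetD jetX Z J) p

lemma sumDZ_nonneg (k : ℕ) (J : Jet) (p : Spacetime) : 0 ≤ sumDZ k J p := by
  induction k generalizing J with
  | zero => exact Finset.sum_nonneg fun _ _ => abs_nonneg _
  | succ k ih => exact add_nonneg (ih J) (Finset.sum_nonneg fun Z _ => ih _)

lemma abs_le_sumDZ (k : ℕ) (J : Jet) (p : Spacetime) (β : Fin 4) : |J [β] p| ≤ sumDZ k J p := by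
  induction k with
  | zero =>
    exact Finset.single_le_sum (f := fun β => |J [β] p|) (fun _ _ => abs_nonneg _)
      (Finset.mem_univ β)
  | succ k ih => exact ih.trans (le_add_of_nonneg_right
      (Finset.sum_nonneg fun Z _ => sumDZ_nonneg _ _ _))

/-- `one_add_norm_mul_abs_le` applied to `∂_α u`, with `Z` moved past `∂_α`. The factor `22 = 2 · 11`
collects the commutators with the eleven fields. -/
lemma one_add_norm_mul_abs_second_le {T : ℝ} {p : Spacetime} (hp : |p.1| ≤ T) {J : Jet}
    (h : SymmAt 2 p J) (α β : Fin 4) :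
    (1 + ‖p.2‖) * |J [β, α] p| ≤ (8 + 6 * T) * 22 * sumDZ 1 J p := by
  have hT : 0 ≤ T := (abs_nonneg _).trans hp
  have h1 := one_add_norm_mul_abs_le hp (jetD α J) β
  have h2 : ∀ Z, |applyZ jetD jetX Z (jetD α J) [] p|
      ≤ sumDZ 0 (applyZ jetD jetX Z J) p + 2 * sumDZ 0 J p := by
    intro Z
    have h3 := abs_applyZ_jetD_sub_le h Z α [] (by simp)
    have h4 := abs_sub_abs_le_abs_sub (applyZ jetD jetX Z (jetD α J) [] p)
      (applyZ jetD jetX Z J ([] ++ [α]) p)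
    have h5 := abs_le_sumDZ 0 (applyZ jetD jetX Z J) p α
    simp only [List.nil_append] at h3 h4
    have h6 : sumDZ 0 J p = ∑ β, |J [β] p| := rfl
    rw [h6]
    linarith
  refine h1.trans ?_
  rw [mul_assoc]
  refine mul_le_mul_of_nonneg_left ?_ (by positivity)
  refine (Finset.sum_le_sum fun Z _ => h2 Z).trans ?_
  rw [Finset.sum_add_distrib, Finset.sum_const, Finset.card_univ]
  have h7 : Fintype.card ZField = 11 := by decide
  rw [h7]
  have h8 : sumDZ 1 J p = sumDZ 0 J p + ∑ Z, sumDZ 0 (applyZ jetD jetX Z J) p := rfl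
  rw [h8]
  have h9 := sumDZ_nonneg 0 J p
  have h10 : 0 ≤ ∑ Z, sumDZ 0 (applyZ jetD jetX Z J) p :=
    Finset.sum_nonneg fun Z _ => sumDZ_nonneg 0 _ p
  simp only [nsmul_eq_mul]
  push_cast
  linarith

/-- `one_add_norm_mul_abs_le` applied to `∂_β ∂_α u`, with `Z` moved past `∂_β` and then past `∂_α`.
The factor `177 = 1 + 11 · 16` collects the commutators with the eleven fields. -/
lemma sq_one_add_norm_mul_abs_third_le {T : ℝ} {p : Spacetime} (hp : |p.1| ≤ T) {J : Jet}
    (h : SymmAt 3 p J) (α β γ : Fin 4) :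
    (1 + ‖p.2‖) ^ 2 * |J [γ, β, α] p|
      ≤ (8 + 6 * T) * ((8 + 6 * T) * 22) * 177 * sumDZ 2 J p := by
  have hT : 0 ≤ T := (abs_nonneg _).trans hp
  set ρ := 1 + ‖p.2‖ with hρ
  have hρ0 : 0 ≤ ρ := by positivity
  set c := (8 + 6 * T) * 22 with hc
  have hc0 : 0 ≤ c := by positivity
  have h1 := one_add_norm_mul_abs_le hp (jetD β (jetD α J)) γ
  have hs := fun β' α' => one_add_norm_mul_abs_second_le hp (h.mono (by norm_num)) α' β'
  have h2 : ∀ Z, ρ * |applyZ jetD jetX Z (jetD β (jetD α J)) [] p|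
      ≤ c * sumDZ 1 (applyZ jetD jetX Z J) p + 16 * (c * sumDZ 1 J p) := by
    intro Z
    have hZ : SymmAt 2 p (applyZ jetD jetX Z J) := SymmAt.applyZ h Z
    have h3 := abs_applyZ_jetD_sub_le (SymmAt.jetD h α) Z β [] (by simp)
    have h4 := abs_applyZ_jetD_sub_le h Z α [β] (by simp)
    simp only [List.nil_append, List.cons_append, jetD] at h3 h4
    have h5 := one_add_norm_mul_abs_second_le hp hZ α β
    have h6 : |applyZ jetD jetX Z (jetD β (jetD α J)) [] p| ≤
        |applyZ jetD jetX Z J [β, α] p| + 2 * ∑ δ, |J [δ, α] p| + 2 * ∑ δ, |J [β, δ] p| := by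
      have h7 := abs_sub_abs_le_abs_sub (applyZ jetD jetX Z (jetD β (jetD α J)) [] p)
        (applyZ jetD jetX Z (jetD α J) [β] p)
      have h8 := abs_sub_abs_le_abs_sub (applyZ jetD jetX Z (jetD α J) [β] p)
        (applyZ jetD jetX Z J [β, α] p)
      linarith
    have h9 : ∀ f : Fin 4 → ℝ, (∀ δ, ρ * |f δ| ≤ c * sumDZ 1 J p) →
        ρ * (2 * ∑ δ, |f δ|) ≤ 8 * (c * sumDZ 1 J p) := by
      intro f hf
      rw [mul_left_comm, Finset.mul_sum]
      have := Finset.sum_le_card_nsmul Finset.univ (fun δ => ρ * |f δ|) _ fun δ _ => hf δ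
      simp only [Finset.card_univ, Fintype.card_fin, nsmul_eq_mul] at this
      push_cast at this
      linarith
    have h10 := h9 (fun δ => J [δ, α] p) fun δ => hs δ α
    have h11 := h9 (fun δ => J [β, δ] p) fun δ => hs β δ
    have h12 := mul_le_mul_of_nonneg_left h6 hρ0
    rw [mul_add, mul_add] at h12
    linarith
  have h3 : ρ * ∑ Z, |applyZ jetD jetX Z (jetD β (jetD α J)) [] p| ≤ c * 177 * sumDZ 2 J p := by
    rw [Finset.mul_sum]
    refine (Finset.sum_le_sum fun Z _ => h2 Z).trans ?_
    rw [Finset.sum_add_distrib, Finset.sum_const, Finset.card_univ, ← Finset.mul_sum]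
    have h7 : Fintype.card ZField = 11 := by decide
    rw [h7]
    have h8 : sumDZ 2 J p = sumDZ 1 J p + ∑ Z, sumDZ 1 (applyZ jetD jetX Z J) p := rfl
    rw [h8]
    have h9 := mul_nonneg hc0 (sumDZ_nonneg 1 J p)
    have h10 : 0 ≤ c * ∑ Z, sumDZ 1 (applyZ jetD jetX Z J) p :=
      mul_nonneg hc0 (Finset.sum_nonneg fun Z _ => sumDZ_nonneg 1 _ p)
    simp only [nsmul_eq_mul]
    push_cast
    linarith
  have h4 : J [γ, β, α] p = jetD β (jetD α J) [γ] p := rfl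
  calc ρ ^ 2 * |J [γ, β, α] p| = ρ * (ρ * |jetD β (jetD α J) [γ] p|) := by rw [h4]; ring
    _ ≤ ρ * ((8 + 6 * T) * ∑ Z, |applyZ jetD jetX Z (jetD β (jetD α J)) [] p|) :=
        mul_le_mul_of_nonneg_left h1 hρ0
    _ = (8 + 6 * T) * (ρ * ∑ Z, |applyZ jetD jetX Z (jetD β (jetD α J)) [] p|) := by ring
    _ ≤ (8 + 6 * T) * (c * 177 * sumDZ 2 J p) := mul_le_mul_of_nonneg_left h3 (by positivity)
    _ = _ := by ring

/-! ### A scaled Sobolev inequality on balls of `ℝ³` -/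

/-- Two integrations by parts against `s` and the cutoff `(1 - s/ρ)²`. -/
lemma abs_zero_le_integral {h h' h'' : ℝ → ℝ} {ρ : ℝ} (hρ : 0 < ρ)
    (h1 : ∀ s, HasDerivAt h (h' s) s) (h2 : ∀ s, HasDerivAt h' (h'' s) s)
    (h3 : Continuous h'') :
    |h 0| ≤ ∫ s in (0 : ℝ)..ρ, 4 * (ρ ^ 2)⁻¹ * (s * (|h s| + ρ * |h' s| + ρ ^ 2 * |h'' s|)) := by
  have c1 : Continuous h := continuous_iff_continuousAt.2 fun s => (h1 s).continuousAt
  have c2 : Continuous h' := continuous_iff_continuousAt.2 fun s => (h2 s).continuousAt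
  have hd : ∀ s, HasDerivAt
      (fun s => s * (-2 / ρ * (1 - s / ρ) * h s + (1 - s / ρ) ^ 2 * h' s) - (1 - s / ρ) ^ 2 * h s)
      (s * (2 / ρ ^ 2 * h s - 4 / ρ * (1 - s / ρ) * h' s + (1 - s / ρ) ^ 2 * h'' s)) s := by
    intro s
    have hq : HasDerivAt (fun s : ℝ => 1 - s / ρ) (-(1 / ρ)) s := by
      simpa using ((hasDerivAt_id s).div_const ρ).const_sub 1
    have := ((hasDerivAt_id s).mul (((hq.const_mul (-2 / ρ)).mul (h1 s)).add
      ((hq.pow 2).mul (h2 s)))).sub ((hq.pow 2).mul (h1 s))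
    refine this.congr_deriv ?_
    simp only [id, Pi.add_apply, Pi.mul_apply, Pi.pow_apply]
    push_cast
    ring
  have e := intervalIntegral.integral_eq_sub_of_hasDerivAt (a := 0) (b := ρ) (fun s _ => hd s)
    (Continuous.intervalIntegrable (by fun_prop) _ _)
  have e1 : h 0 = ∫ s in (0 : ℝ)..ρ,
      s * (2 / ρ ^ 2 * h s - 4 / ρ * (1 - s / ρ) * h' s + (1 - s / ρ) ^ 2 * h'' s) := by
    rw [e]
    field_simp
    ring
  rw [e1]
  refine (intervalIntegral.abs_integral_le_integral_abs hρ.le).trans ?_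
  refine intervalIntegral.integral_mono_on hρ.le (Continuous.intervalIntegrable (by fun_prop) _ _)
    (Continuous.intervalIntegrable (by fun_prop) _ _) fun s hs => ?_
  have hq0 : 0 ≤ 1 - s / ρ := by rw [sub_nonneg, div_le_one hρ]; exact hs.2
  have hq1 : 1 - s / ρ ≤ 1 := by have := div_nonneg hs.1 hρ.le; linarith
  rw [abs_mul, abs_of_nonneg hs.1, mul_left_comm]
  refine mul_le_mul_of_nonneg_left ?_ hs.1
  refine (abs_add_le _ _).trans ((add_le_add_left (abs_sub _ _) _).trans ?_)
  rw [abs_mul, abs_mul, abs_mul, abs_mul, abs_of_nonneg hq0,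
    abs_of_nonneg (a := 2 / ρ ^ 2) (by positivity), abs_of_nonneg (a := 4 / ρ) (by positivity),
    abs_of_nonneg (a := (1 - s / ρ) ^ 2) (by positivity)]
  have i1 : 4 / ρ * (1 - s / ρ) * |h' s| ≤ 4 / ρ * |h' s| := by
    refine mul_le_mul_of_nonneg_right ?_ (abs_nonneg _)
    exact mul_le_of_le_one_right (by positivity) hq1
  have i2 : (1 - s / ρ) ^ 2 * |h'' s| ≤ |h'' s| :=
    mul_le_of_le_one_left (abs_nonneg _) (pow_le_one₀ hq0 hq1)
  have i3 : 4 * (ρ ^ 2)⁻¹ * (|h s| + ρ * |h' s| + ρ ^ 2 * |h'' s|)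
      = 4 / ρ ^ 2 * |h s| + 4 / ρ * |h' s| + 4 * |h'' s| := by field_simp
  rw [i3]
  have i4 : 2 / ρ ^ 2 * |h s| ≤ 4 / ρ ^ 2 * |h s| := by gcongr; norm_num
  linarith [abs_nonneg (h'' s)]

/-- Integration in polar coordinates. -/
lemma lintegral_eq_lintegral_sphere {F : Space → ℝ≥0∞} (hF : Measurable F) :
    ∫⁻ y, F y = ∫⁻ θ, (∫⁻ s in Set.Ioi (0 : ℝ), ENNReal.ofReal (s ^ 2) * F (s • (θ : Space)))
      ∂(volume : Measure Space).toSphere := by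
  have hmp := (volume : Measure Space).measurePreserving_homeomorphUnitSphereProd
  have hdim : Module.finrank ℝ Space - 1 = 2 := by simp
  rw [hdim] at hmp
  have e1 : ∫⁻ y, F y = ∫⁻ y : ({(0 : Space)}ᶜ : Set Space), F y ∂(volume.comap Subtype.val) := by
    rw [lintegral_subtype_comap (measurableSet_singleton _).compl, restrict_compl_singleton]
  have e2 : ∫⁻ y : ({(0 : Space)}ᶜ : Set Space), F y ∂(volume.comap Subtype.val)
      = ∫⁻ z, F (z.2.1 • (z.1 : Space))
          ∂((volume : Measure Space).toSphere.prod (Measure.volumeIoiPow 2)) := by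
    rw [← hmp.lintegral_comp (by fun_prop)]
    refine lintegral_congr fun y => ?_
    congr 1
    have h := (homeomorphUnitSphereProd Space).symm_apply_apply y
    conv_lhs => rw [← h]
    rw [homeomorphUnitSphereProd_symm_apply_coe]
  rw [e1, e2, lintegral_prod _ (by fun_prop)]
  refine lintegral_congr fun θ => ?_
  rw [Measure.volumeIoiPow, lintegral_withDensity_eq_lintegral_mul _ (by fun_prop) (by fun_prop)]
  exact lintegral_subtype_comap measurableSet_Ioi
    (fun s : ℝ => ENNReal.ofReal (s ^ 2) * F (s • (θ : Space)))

/-- The covector on `ℝ³` with components `c`. -/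
noncomputable def covec (c : Fin 3 → ℝ) : Space →L[ℝ] ℝ :=
  ∑ i, c i • (EuclideanSpace.proj i : Space →L[ℝ] ℝ)

lemma covec_apply (c : Fin 3 → ℝ) (v : Space) : covec c v = ∑ i, c i * v i := by
  simp [covec]

lemma abs_coord_le_one (θ : Metric.sphere (0 : Space) 1) (i : Fin 3) : |(θ : Space) i| ≤ 1 := by
  have h := PiLp.norm_apply_le (θ : Space) i
  rwa [norm_eq_of_mem_sphere, Real.norm_eq_abs] at h

/-- The left side of the Sobolev inequality is bounded along every ray from `x`. -/
lemma abs_le_integral_ray {f : Space → ℝ} {f₁ : Fin 3 → Space → ℝ} {f₂ : Fin 3 → Fin 3 → Space → ℝ}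
    (h₁ : ∀ y, HasFDerivAt f (covec fun i => f₁ i y) y)
    (h₂ : ∀ i y, HasFDerivAt (f₁ i) (covec fun j => f₂ j i y) y)
    (h₃ : ∀ j i, Continuous (f₂ j i)) {ρ : ℝ} (hρ : 0 < ρ) (x : Space)
    (θ : Metric.sphere (0 : Space) 1) :
    |f x| ≤ ∫ s in (0 : ℝ)..ρ, 4 * (ρ ^ 2)⁻¹ * (s * (|f (x + s • (θ : Space))|
      + ρ * ∑ i, |f₁ i (x + s • (θ : Space))|
      + ρ ^ 2 * ∑ i, ∑ j, |f₂ j i (x + s • (θ : Space))|)) := by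
  have hl : ∀ s : ℝ, HasDerivAt (fun s : ℝ => x + s • (θ : Space)) (θ : Space) s := by
    intro s
    simpa using ((hasDerivAt_id s).smul_const (θ : Space)).const_add x
  have c0 : Continuous f := continuous_iff_continuousAt.2 fun y => (h₁ y).continuousAt
  have c1 : ∀ i, Continuous (f₁ i) := fun i =>
    continuous_iff_continuousAt.2 fun y => (h₂ i y).continuousAt
  have d1 : ∀ s, HasDerivAt (fun s : ℝ => f (x + s • (θ : Space)))
      (∑ i, f₁ i (x + s • (θ : Space)) * (θ : Space) i) s := fun s => by
    have := (h₁ (x + s • (θ : Space))).comp_hasDerivAt s (hl s)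
    rwa [covec_apply] at this
  have d2 : ∀ s, HasDerivAt (fun s : ℝ => ∑ i, f₁ i (x + s • (θ : Space)) * (θ : Space) i)
      (∑ i, (∑ j, f₂ j i (x + s • (θ : Space)) * (θ : Space) j) * (θ : Space) i) s := fun s => by
    refine HasDerivAt.fun_sum fun i _ => ?_
    have := (h₂ i (x + s • (θ : Space))).comp_hasDerivAt s (hl s)
    rw [covec_apply] at this
    exact this.mul_const _
  have := abs_zero_le_integral hρ d1 d2 (by fun_prop)
  rw [zero_smul, add_zero] at this
  refine this.trans (intervalIntegral.integral_mono_on hρ.le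
    (Continuous.intervalIntegrable (by fun_prop) _ _)
    (Continuous.intervalIntegrable (by fun_prop) _ _) fun s hs => ?_)
  have hs0 := hs.1
  have hab : ∀ (c : ℝ) i, |c * (θ : Space) i| ≤ |c| := fun c i => by
    rw [abs_mul]
    exact mul_le_of_le_one_right (abs_nonneg _) (abs_coord_le_one θ i)
  gcongr
  · exact (Finset.abs_sum_le_sum_abs _ _).trans (Finset.sum_le_sum fun i _ => hab _ i)
  · refine (Finset.abs_sum_le_sum_abs _ _).trans (Finset.sum_le_sum fun i _ => (hab _ i).trans ?_)
    exact (Finset.abs_sum_le_sum_abs _ _).trans (Finset.sum_le_sum fun j _ => hab _ j)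

/-- The Sobolev embedding `H² ⊂ L^∞` on balls of `ℝ³`, in scaling invariant form. The function
`s ↦ s` produced by two integrations along rays is `|y|⁻¹` times the density `s²` of polar
coordinates, and `|y|⁻¹` is square integrable near the origin of `ℝ³`. -/
theorem exists_sobolev_const : ∃ S : ℝ, 0 < S ∧ ∀ (f : Space → ℝ) (f₁ : Fin 3 → Space → ℝ)
    (f₂ : Fin 3 → Fin 3 → Space → ℝ),
    (∀ y, HasFDerivAt f (covec fun i => f₁ i y) y) →
    (∀ i y, HasFDerivAt (f₁ i) (covec fun j => f₂ j i y) y) →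
    (∀ j i, Continuous (f₂ j i)) → ∀ (ρ : ℝ), 0 < ρ → ∀ (x : Space) (G : Space → ℝ),
    (∀ y ∈ Metric.ball x ρ, |f y| + ρ * ∑ i, |f₁ i y| + ρ ^ 2 * ∑ i, ∑ j, |f₂ j i y| ≤ G y) →
    ENNReal.ofReal |f x| ≤ ENNReal.ofReal (S * ρ ^ (-(3 / 2) : ℝ))
      * eLpNorm G 2 (volume.restrict (Metric.ball x ρ)) := by
  set σ := (volume : Measure Space).toSphere Set.univ with hσ
  have hσ0 : σ ≠ 0 := by
    rw [hσ, Measure.measure_univ_ne_zero]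
    exact Measure.toSphere_ne_zero _
  have hσt : σ ≠ ⊤ := measure_ne_top _ _
  have hσr : 0 < σ.toReal := ENNReal.toReal_pos hσ0 hσt
  refine ⟨4 * σ.toReal ^ (-(1 / 2) : ℝ), by positivity, ?_⟩
  intro f f₁ f₂ h₁ h₂ h₃ ρ hρ x G hG
  have c0 : Continuous f := continuous_iff_continuousAt.2 fun y => (h₁ y).continuousAt
  have c1 : ∀ i, Continuous (f₁ i) := fun i =>
    continuous_iff_continuousAt.2 fun y => (h₂ i y).continuousAt
  set g : Space → ℝ := fun y => |f y| + ρ * ∑ i, |f₁ i y| + ρ ^ 2 * ∑ i, ∑ j, |f₂ j i y| with hg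
  have cg : Continuous g := by rw [hg]; fun_prop
  have g0 : ∀ y, 0 ≤ g y := fun y => by rw [hg]; positivity
  set B : Set Space := Metric.ball 0 ρ with hB
  have hBm : MeasurableSet B := measurableSet_ball
  have polar : ∀ F : Space → ℝ≥0∞, Measurable F → ∫⁻ y in B, F y
      = ∫⁻ θ, (∫⁻ s in Set.Ioo (0 : ℝ) ρ, ENNReal.ofReal (s ^ 2) * F (s • (θ : Space)))
        ∂(volume : Measure Space).toSphere := by
    intro F hF
    rw [← lintegral_indicator hBm, lintegral_eq_lintegral_sphere (hF.indicator hBm)]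
    refine lintegral_congr fun θ => ?_
    have : ∀ s ∈ Set.Ioi (0 : ℝ), ENNReal.ofReal (s ^ 2) * B.indicator F (s • (θ : Space))
        = (Set.Iio ρ).indicator
          (fun s => ENNReal.ofReal (s ^ 2) * F (s • (θ : Space))) s := by
      intro s hs
      have hn : ‖s • (θ : Space)‖ = s := by
        rw [norm_smul, norm_eq_of_mem_sphere, mul_one, Real.norm_of_nonneg (le_of_lt hs)]
      by_cases h : s < ρ
      · rw [Set.indicator_of_mem (by simpa [hB, hn] using h), Set.indicator_of_mem (by exact h)]
      · rw [Set.indicator_of_notMem (by simpa [hB, hn] using h),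
          Set.indicator_of_notMem (by simpa using h), mul_zero]
    rw [setLIntegral_congr_fun measurableSet_Ioi this, lintegral_indicator measurableSet_Iio,
      Measure.restrict_restrict measurableSet_Iio, Set.inter_comm, Set.Ioi_inter_Iio]
  -- the integral of `|y|⁻²` over the ball
  have hk : ∫⁻ y in B, ENNReal.ofReal ‖y‖⁻¹ ^ (2 : ℝ) = σ * ENNReal.ofReal ρ := by
    rw [polar _ (by fun_prop)]
    have : ∀ θ : Metric.sphere (0 : Space) 1, ∫⁻ s in Set.Ioo (0 : ℝ) ρ, ENNReal.ofReal (s ^ 2)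
        * ENNReal.ofReal ‖s • (θ : Space)‖⁻¹ ^ (2 : ℝ) = ENNReal.ofReal ρ := by
      intro θ
      have : ∀ s ∈ Set.Ioo (0 : ℝ) ρ, ENNReal.ofReal (s ^ 2)
        * ENNReal.ofReal ‖s • (θ : Space)‖⁻¹ ^ (2 : ℝ) = 1 := by
        intro s hs
        have hs0 : 0 < s := hs.1
        rw [norm_smul, norm_eq_of_mem_sphere, mul_one, Real.norm_of_nonneg hs0.le,
          ENNReal.rpow_ofNat, ← ENNReal.ofReal_pow (by positivity),
          ← ENNReal.ofReal_mul (by positivity), inv_pow, mul_inv_cancel₀ (by positivity),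
          ENNReal.ofReal_one]
      rw [setLIntegral_congr_fun measurableSet_Ioo this]
      simp
    rw [lintegral_congr this, lintegral_const, mul_comm]
  -- average of the bound along rays over all directions
  have hray : ∀ θ : Metric.sphere (0 : Space) 1, ENNReal.ofReal |f x|
      ≤ ∫⁻ s in Set.Ioo (0 : ℝ) ρ, ENNReal.ofReal (s ^ 2) * (ENNReal.ofReal (4 * (ρ ^ 2)⁻¹)
        * (ENNReal.ofReal ‖s • (θ : Space)‖⁻¹ * ENNReal.ofReal (g (x + s • (θ : Space))))) := by
    intro θ
    have h := abs_le_integral_ray h₁ h₂ h₃ hρ x θ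
    rw [intervalIntegral.integral_of_le hρ.le] at h
    refine (ENNReal.ofReal_le_ofReal h).trans ?_
    rw [integral_Ioc_eq_integral_Ioo]
    have hc : Continuous fun s : ℝ => 4 * (ρ ^ 2)⁻¹ * (s * g (x + s • (θ : Space))) := by fun_prop
    rw [ofReal_integral_eq_lintegral_ofReal]
    · refine lintegral_mono_ae ?_
      filter_upwards [ae_restrict_mem measurableSet_Ioo] with s hs
      have hs0 : 0 < s := hs.1
      rw [norm_smul, norm_eq_of_mem_sphere, mul_one, Real.norm_of_nonneg hs0.le,
        ← ENNReal.ofReal_mul (by positivity), ← ENNReal.ofReal_mul (by positivity),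
        ← ENNReal.ofReal_mul (by positivity)]
      refine ENNReal.ofReal_le_ofReal (le_of_eq ?_)
      change 4 * (ρ ^ 2)⁻¹ * (s * g (x + s • (θ : Space))) = _
      field_simp
    · exact (hc.integrableOn_Icc (a := 0) (b := ρ)).mono_set Set.Ioo_subset_Icc_self
    · filter_upwards [ae_restrict_mem measurableSet_Ioo] with s hs
      have hs0 : 0 < s := hs.1
      have := g0 (x + s • (θ : Space))
      change 0 ≤ 4 * (ρ ^ 2)⁻¹ * (s * g (x + s • (θ : Space)))
      positivity
  have havg : σ * ENNReal.ofReal |f x| ≤ ENNReal.ofReal (4 * (ρ ^ 2)⁻¹)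
      * ∫⁻ y in B, (ENNReal.ofReal ‖y‖⁻¹ * ENNReal.ofReal (g (x + y))) := by
    rw [← lintegral_const_mul _ (by fun_prop), polar _ (by fun_prop)]
    refine le_trans (le_of_eq ?_) (lintegral_mono hray)
    rw [lintegral_const, mul_comm]
  have hN : (∫⁻ y in B, ENNReal.ofReal (g (x + y)) ^ (2 : ℝ)) ^ (1 / 2 : ℝ)
      ≤ eLpNorm G 2 (volume.restrict (Metric.ball x ρ)) := by
    have hmp : MeasurePreserving (fun y : Space => x + y) (volume.restrict B)
        (volume.restrict (Metric.ball x ρ)) := by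
      have := (measurePreserving_add_left (volume : Measure Space) x).restrict_preimage
        (s := Metric.ball x ρ) measurableSet_ball
      convert this using 2
      ext y
      simp [hB, dist_eq_norm]
    have e : ∫⁻ y in B, ENNReal.ofReal (g (x + y)) ^ (2 : ℝ)
        = ∫⁻ y in Metric.ball x ρ, ENNReal.ofReal (g y) ^ (2 : ℝ) :=
      hmp.lintegral_comp (f := fun y => ENNReal.ofReal (g y) ^ (2 : ℝ)) (by fun_prop)
    rw [e, eLpNorm_eq_lintegral_rpow_enorm_toReal two_ne_zero ENNReal.ofNat_ne_top]
    simp only [ENNReal.toReal_ofNat]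
    refine ENNReal.rpow_le_rpow (lintegral_mono_ae ?_) (by norm_num)
    filter_upwards [ae_restrict_mem measurableSet_ball] with y hy
    refine ENNReal.rpow_le_rpow ?_ (by norm_num)
    rw [Real.enorm_eq_ofReal_abs]
    exact ENNReal.ofReal_le_ofReal ((hG y hy).trans (le_abs_self _))
  have hCS := ENNReal.lintegral_mul_le_Lp_mul_Lq (volume.restrict B) Real.HolderConjugate.two_two
    (f := fun y => ENNReal.ofReal ‖y‖⁻¹) (g := fun y => ENNReal.ofReal (g (x + y)))
    (by fun_prop) (by fun_prop)
  rw [hk] at hCS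
  have hall : σ * ENNReal.ofReal |f x| ≤ ENNReal.ofReal (4 * (ρ ^ 2)⁻¹)
      * ((σ * ENNReal.ofReal ρ) ^ (1 / 2 : ℝ)
        * eLpNorm G 2 (volume.restrict (Metric.ball x ρ))) := by
    refine havg.trans (mul_le_mul_right ?_ _)
    exact hCS.trans (mul_le_mul_right hN _)
  have hfin : ENNReal.ofReal (4 * (ρ ^ 2)⁻¹) * (σ * ENNReal.ofReal ρ) ^ (1 / 2 : ℝ)
      = σ * ENNReal.ofReal (4 * σ.toReal ^ (-(1 / 2) : ℝ) * ρ ^ (-(3 / 2) : ℝ)) := by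
    nth_rw 1 2 [← ENNReal.ofReal_toReal hσt]
    rw [← ENNReal.ofReal_mul hσr.le, ENNReal.ofReal_rpow_of_pos (by positivity),
      ← ENNReal.ofReal_mul (by positivity), ← ENNReal.ofReal_mul hσr.le]
    congr 1
    rw [Real.mul_rpow hσr.le hρ.le]
    have e1 : σ.toReal ^ (1 / 2 : ℝ) = σ.toReal * σ.toReal ^ (-(1 / 2) : ℝ) := by
      nth_rw 2 [← Real.rpow_one σ.toReal]
      rw [← Real.rpow_add hσr]; norm_num
    have e2 : (ρ ^ 2)⁻¹ * ρ ^ (1 / 2 : ℝ) = ρ ^ (-(3 / 2) : ℝ) := by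
      rw [← Real.rpow_natCast, ← Real.rpow_neg hρ.le, ← Real.rpow_add hρ]; norm_num
    rw [e1, ← e2]
    ring
  rw [← mul_assoc, hfin, mul_assoc] at hall
  exact (ENNReal.mul_le_mul_iff_right hσ0 hσt).1 hall

/-! ### Mollification on `ℝ³` -/

/-- A smooth nonnegative function of integral one supported in the ball of radius `1 / (n + 1)`. -/
noncomputable def mollBump (n : ℕ) : ContDiffBump (0 : Space) where
  rIn := 1 / (2 * (n + 1))
  rOut := 1 / (n + 1)
  rIn_pos := by positivity
  rIn_lt_rOut := by
    rw [one_div, one_div, mul_inv]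
    have : (0 : ℝ) < ((n : ℝ) + 1)⁻¹ := by positivity
    linarith

/-- The mollifier `η_n`. -/
noncomputable def mollifier (n : ℕ) : Space → ℝ := (mollBump n).normed volume

lemma contDiff_mollifier (n : ℕ) : ContDiff ℝ ∞ (mollifier n) :=
  (mollBump n).contDiff_normed (n := ⊤)

lemma continuous_mollifier (n : ℕ) : Continuous (mollifier n) := (contDiff_mollifier n).continuous

lemma hasCompactSupport_mollifier (n : ℕ) : HasCompactSupport (mollifier n) :=
  (mollBump n).hasCompactSupport_normed

lemma tendsto_rOut_mollBump : Tendsto (fun n => (mollBump n).rOut) atTop (𝓝 0) :=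
  tendsto_one_div_add_atTop_nhds_zero_nat

/-- The mollification `g ⋆ η_n`. -/
noncomputable def mollify (n : ℕ) (g : Space → ℝ) (x : Space) : ℝ :=
  ∫ y, g y * mollifier n (x - y)

lemma mollify_eq_convolution (n : ℕ) (g : Space → ℝ) :
    mollify n g = convolution g (mollifier n) (ContinuousLinearMap.mul ℝ ℝ) volume := rfl

lemma mollifier_nonneg (n : ℕ) (y : Space) : 0 ≤ mollifier n y := (mollBump n).nonneg_normed y

/-- The mollifier as the density of a probability measure. -/
noncomputable def mollMeasure (n : ℕ) : Measure Space :=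
  volume.withDensity fun y => ENNReal.ofReal (mollifier n y)

instance (n : ℕ) : IsProbabilityMeasure (mollMeasure n) := by
  constructor
  rw [mollMeasure, withDensity_apply _ MeasurableSet.univ, Measure.restrict_univ,
    ← ofReal_integral_eq_lintegral_ofReal]
  · rw [show ∫ y, mollifier n y = 1 from (mollBump n).integral_normed, ENNReal.ofReal_one]
  · exact (mollBump n).integrable_normed
  · exact Eventually.of_forall (mollBump n).nonneg_normed

lemma integral_mollMeasure (n : ℕ) (g : Space → ℝ) :
    ∫ y, g y ∂mollMeasure n = ∫ y, mollifier n y * g y := by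
  have hm := (continuous_mollifier n).measurable
  rw [mollMeasure, integral_withDensity_eq_integral_toReal_smul (by fun_prop)
    (Eventually.of_forall fun _ => ENNReal.ofReal_lt_top)]
  refine integral_congr_ae (Eventually.of_forall fun y => ?_)
  simp only [smul_eq_mul]
  rw [ENNReal.toReal_ofReal (mollifier_nonneg n y)]

lemma mollify_eq_integral (n : ℕ) (g : Space → ℝ) (x : Space) :
    mollify n g x = ∫ y, g (x - y) ∂mollMeasure n := by
  rw [integral_mollMeasure, mollify,
    ← integral_sub_left_eq_self (fun y => g y * mollifier n (x - y)) volume x]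
  refine integral_congr_ae (Eventually.of_forall fun y => ?_)
  simp only [sub_sub_cancel]
  ring

lemma ae_mollMeasure_mem_ball (n : ℕ) :
    ∀ᵐ y ∂mollMeasure n, y ∈ Metric.ball (0 : Space) (mollBump n).rOut := by
  have hm := (continuous_mollifier n).measurable
  rw [mollMeasure, ae_withDensity_iff (by fun_prop)]
  refine Eventually.of_forall fun y hy => ?_
  rw [← (mollBump n).support_normed_eq (μ := volume)]
  intro h
  exact hy (by rw [show mollifier n y = 0 from h, ENNReal.ofReal_zero])

lemma mollify_congr_ae {n : ℕ} {g g' : Space → ℝ} (h : g =ᵐ[volume] g') :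
    mollify n g = mollify n g' := by
  ext x
  refine integral_congr_ae ?_
  filter_upwards [h] with y hy
  rw [hy]

lemma integrable_mul_mollifier {g : Space → ℝ} (hg : LocallyIntegrable g) (n : ℕ) (x : Space) :
    Integrable fun y => g y * mollifier n (x - y) :=
  (hasCompactSupport_mollifier n).convolutionExists_right (ContinuousLinearMap.mul ℝ ℝ) hg
    (continuous_mollifier n) x

lemma integrable_mollMeasure {g : Space → ℝ} (hg : LocallyIntegrable g) (n : ℕ) (x : Space) :
    Integrable (fun y => g (x - y)) (mollMeasure n) := by
  have hη := (continuous_mollifier n).measurable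
  rw [mollMeasure, integrable_withDensity_iff_integrable_smul' (by fun_prop)
    (Eventually.of_forall fun _ => ENNReal.ofReal_lt_top)]
  refine ((integrable_mul_mollifier hg n x).comp_sub_left x).congr
    (Eventually.of_forall fun y => ?_)
  simp only [sub_sub_cancel, smul_eq_mul]
  rw [ENNReal.toReal_ofReal (mollifier_nonneg n y), mul_comm]

lemma mollify_sub {g g' : Space → ℝ} (hg : LocallyIntegrable g) (hg' : LocallyIntegrable g')
    (n : ℕ) (x : Space) : mollify n (fun y => g y - g' y) x = mollify n g x - mollify n g' x := by
  simp only [mollify, sub_mul]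
  exact integral_sub (integrable_mul_mollifier hg n x) (integrable_mul_mollifier hg' n x)

lemma mollify_const_mul (n : ℕ) (c : ℝ) (g : Space → ℝ) (x : Space) :
    mollify n (fun y => c * g y) x = c * mollify n g x := by
  simp only [mollify, mul_assoc]
  exact integral_const_mul _ _

lemma continuous_mollify {g : Space → ℝ} (hg : LocallyIntegrable g) (n : ℕ) :
    Continuous (mollify n g) := by
  rw [mollify_eq_convolution]
  exact (hasCompactSupport_mollifier n).continuous_convolution_right _ hg (continuous_mollifier n)

/-- Mollification commutes with weak derivatives. -/
lemma hasFDerivAt_mollify {g : Space → ℝ} {g₁ : Fin 3 → Space → ℝ} (hg : LocallyIntegrable g)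
    (hw : ∀ i, ∀ φ : Space → ℝ, ContDiff ℝ ∞ φ → HasCompactSupport φ →
      ∫ x, g x * fderiv ℝ φ x (EuclideanSpace.single i 1) = -∫ x, g₁ i x * φ x)
    (n : ℕ) (x : Space) :
    HasFDerivAt (mollify n g) (covec fun i => mollify n (g₁ i) x) x := by
  have hη1 : ContDiff ℝ 1 (mollifier n) := (contDiff_mollifier n).of_le (by norm_num)
  have h := (hasCompactSupport_mollifier n).hasFDerivAt_convolution_right
    (ContinuousLinearMap.mul ℝ ℝ) hg hη1 x
  rw [← mollify_eq_convolution] at h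
  refine h.congr_fderiv ?_
  refine ContinuousLinearMap.coe_injective
    ((EuclideanSpace.basisFun (Fin 3) ℝ).toBasis.ext fun i => ?_)
  simp only [OrthonormalBasis.coe_toBasis, EuclideanSpace.basisFun_apply,
    ContinuousLinearMap.coe_coe]
  rw [convolution_precompR_apply _ hg ((hasCompactSupport_mollifier n).fderiv ℝ)
    (hη1.continuous_fderiv one_ne_zero), covec_apply]
  have e : ∑ j, mollify n (g₁ j) x * (EuclideanSpace.single i (1 : ℝ) : Space) j
      = mollify n (g₁ i) x := by
    simp
  rw [e]
  have hsm : ContDiff ℝ ∞ fun y => mollifier n (x - y) :=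
    (contDiff_mollifier n).comp (contDiff_const.sub contDiff_id)
  have hcs : HasCompactSupport fun y => mollifier n (x - y) :=
    (hasCompactSupport_mollifier n).comp_homeomorph (Homeomorph.subLeft x)
  have hw' := hw i _ hsm hcs
  have hd : ∀ y, fderiv ℝ (fun y => mollifier n (x - y)) y (EuclideanSpace.single i 1)
      = -fderiv ℝ (mollifier n) (x - y) (EuclideanSpace.single i 1) := by
    intro y
    have := ((hη1.differentiable one_ne_zero (x - y)).hasFDerivAt.comp y
      ((hasFDerivAt_id y).const_sub x)).fderiv
    change fderiv ℝ (mollifier n ∘ HSub.hSub x) y _ = _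
    rw [this]
    simp
  simp only [hd, mul_neg, integral_neg, neg_inj] at hw'
  exact hw'

lemma enorm_mollify_le {g : Space → ℝ} (hg : AEStronglyMeasurable g) (n : ℕ) (x : Space) :
    ‖mollify n g x‖ₑ ≤ eLpNorm (mollifier n) 2 * eLpNorm g 2 := by
  have hη := (continuous_mollifier n).aestronglyMeasurable (μ := (volume : Measure Space))
  have hmp : MeasurePreserving (fun y : Space => x - y) volume volume :=
    Measure.measurePreserving_sub_left volume x
  have e : eLpNorm (fun y => mollifier n (x - y)) 2 = eLpNorm (mollifier n) 2 :=
    eLpNorm_comp_measurePreserving hη hmp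
  have h := eLpNorm_smul_le_mul_eLpNorm (p := 2) (q := 2) (r := 1) hg
    (hη.comp_measurePreserving hmp)
  rw [Function.comp_def, e, eLpNorm_one_eq_lintegral_enorm] at h
  refine (enorm_integral_le_lintegral_enorm _).trans (le_trans (le_of_eq ?_) h)
  refine lintegral_congr fun y => ?_
  rw [Pi.smul_apply', smul_eq_mul, mul_comm]

lemma eLpNorm_mollifier_ne_top (n : ℕ) : eLpNorm (mollifier n) 2 ≠ ⊤ :=
  ((continuous_mollifier n).memLp_of_hasCompactSupport (hasCompactSupport_mollifier n)).2.ne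

/-- Minkowski's inequality for averages against a probability measure. -/
lemma eLpNorm_integral_le {ν : Measure Space} [IsProbabilityMeasure ν] {F : Space → Space → ℝ}
    (hF : AEStronglyMeasurable (Function.uncurry F) ((volume : Measure Space).prod ν)) {B : ℝ≥0∞}
    (hB : ∀ᵐ y ∂ν, eLpNorm (fun x => F x y) 2 volume ≤ B) :
    eLpNorm (fun x => ∫ y, F x y ∂ν) 2 volume ≤ B := by
  have h2 : ∀ (μ : Measure Space) (f : Space → ℝ),
      eLpNorm f 2 μ = (∫⁻ x, ‖f x‖ₑ ^ (2 : ℝ) ∂μ) ^ (1 / 2 : ℝ) := fun μ f => by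
    rw [eLpNorm_eq_lintegral_rpow_enorm_toReal two_ne_zero ENNReal.ofNat_ne_top]
    simp
  have h2' : ∀ (μ : Measure Space) (f : Space → ℝ),
      eLpNorm f 2 μ ^ (2 : ℝ) = ∫⁻ x, ‖f x‖ₑ ^ (2 : ℝ) ∂μ := fun μ f => by
    rw [h2, ← ENNReal.rpow_mul]
    norm_num
  have hx : ∀ᵐ x ∂(volume : Measure Space),
      ‖∫ y, F x y ∂ν‖ₑ ^ (2 : ℝ) ≤ ∫⁻ y, ‖F x y‖ₑ ^ (2 : ℝ) ∂ν := by
    filter_upwards [hF.prodMk_left] with x hx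
    rw [← h2']
    refine ENNReal.rpow_le_rpow ?_ (by norm_num)
    refine (enorm_integral_le_lintegral_enorm _).trans ?_
    rw [← eLpNorm_one_eq_lintegral_enorm]
    exact eLpNorm_le_eLpNorm_of_exponent_le (by norm_num) hx
  have hI : ∫⁻ x, ‖∫ y, F x y ∂ν‖ₑ ^ (2 : ℝ) ≤ B ^ (2 : ℝ) := by
    refine (lintegral_mono_ae hx).trans ?_
    rw [lintegral_lintegral_swap (hF.enorm.pow_const _)]
    calc ∫⁻ y, ∫⁻ x, ‖F x y‖ₑ ^ (2 : ℝ) ∂volume ∂ν ≤ ∫⁻ _, B ^ (2 : ℝ) ∂ν := by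
          refine lintegral_mono_ae ?_
          filter_upwards [hB] with y hy
          rw [← h2']
          exact ENNReal.rpow_le_rpow hy (by norm_num)
      _ = B ^ (2 : ℝ) := by simp
  rw [h2]
  calc _ ≤ (B ^ (2 : ℝ)) ^ (1 / 2 : ℝ) := ENNReal.rpow_le_rpow hI (by norm_num)
    _ = B := by rw [← ENNReal.rpow_mul]; norm_num

lemma eLpNorm_comp_sub_right {g : Space → ℝ} (hg : AEStronglyMeasurable g) (y : Space) :
    eLpNorm (fun x => g (x - y)) 2 volume = eLpNorm g 2 volume :=
  eLpNorm_comp_measurePreserving hg (measurePreserving_sub_right volume y)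

lemma eLpNorm_mollify_le {g : Space → ℝ} (hg : AEStronglyMeasurable g) (n : ℕ) :
    eLpNorm (mollify n g) 2 ≤ eLpNorm g 2 := by
  rw [mollify_congr_ae hg.ae_eq_mk, eLpNorm_congr_ae hg.ae_eq_mk]
  have hm := hg.stronglyMeasurable_mk
  have e : mollify n (hg.mk g) = fun x => ∫ y, hg.mk g (x - y) ∂mollMeasure n :=
    funext fun x => mollify_eq_integral n _ x
  rw [e]
  refine eLpNorm_integral_le (F := fun x y => hg.mk g (x - y)) ?_
    (Eventually.of_forall fun y => (eLpNorm_comp_sub_right hm.aestronglyMeasurable y).le)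
  exact (hm.comp_measurable (measurable_fst.sub measurable_snd)).aestronglyMeasurable

/-- Translations act continuously on `L²`. -/
lemma tendsto_eLpNorm_comp_sub {g : Space → ℝ} (hg : MemLp g 2) :
    Tendsto (fun y => eLpNorm (fun x => g (x - y) - g x) 2 volume) (𝓝 (0 : Space)) (𝓝 0) := by
  let τ : C(Space × Space, Space) := ⟨fun p => p.2 - p.1, by fun_prop⟩
  have hτ : ∀ y, MeasurePreserving (τ.curry y) (volume : Measure Space) volume := fun y =>
    measurePreserving_sub_right volume y
  have h := Filter.Tendsto.compMeasurePreservingLp (p := 2) (μ := volume) (ν := volume)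
    (tendsto_const_nhds (x := hg.toLp g) (f := 𝓝 (0 : Space)))
    (τ.curry.continuous.tendsto 0) hτ (hτ 0) ENNReal.ofNat_ne_top
  have e : ∀ y, Lp.compMeasurePreserving (τ.curry y) (hτ y) (hg.toLp g)
      = (hg.comp_measurePreserving (hτ y)).toLp (g ∘ τ.curry y) := fun y =>
    Lp.toLp_compMeasurePreserving hg (hτ y)
  simp only [e] at h
  rw [Lp.tendsto_Lp_iff_tendsto_eLpNorm''] at h
  have h0 : g ∘ τ.curry 0 = g := by ext x; simp [τ]
  rw [h0] at h
  exact h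

lemma tendsto_eLpNorm_mollify_sub {g : Space → ℝ} (hg : MemLp g 2) :
    Tendsto (fun n => eLpNorm (fun x => mollify n g x - g x) 2 volume) atTop (𝓝 0) := by
  rw [ENNReal.tendsto_nhds_zero]
  intro δ hδ
  obtain ⟨r, hr, hball⟩ := Metric.eventually_nhds_iff_ball.1
    (ENNReal.tendsto_nhds_zero.1 (tendsto_eLpNorm_comp_sub hg) δ hδ)
  filter_upwards [tendsto_rOut_mollBump.eventually (gt_mem_nhds hr)] with n hn
  set g' := hg.1.mk g with hg'
  have hm : StronglyMeasurable g' := hg.1.stronglyMeasurable_mk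
  have hgg' : g =ᵐ[volume] g' := hg.1.ae_eq_mk
  have hL : LocallyIntegrable g' := ((memLp_congr_ae hgg').1 hg).locallyIntegrable (by norm_num)
  have e : (fun x => mollify n g x - g x)
      =ᵐ[volume] fun x => ∫ y, (g' (x - y) - g' x) ∂mollMeasure n := by
    filter_upwards [hgg'] with x hx
    rw [mollify_congr_ae hgg', hx, mollify_eq_integral, integral_sub (integrable_mollMeasure hL n x)
      (integrable_const _)]
    simp
  rw [eLpNorm_congr_ae e]
  refine eLpNorm_integral_le (F := fun x y => g' (x - y) - g' x) ?_ ?_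
  · exact ((hm.comp_measurable (measurable_fst.sub measurable_snd)).sub
      (hm.comp_measurable measurable_fst)).aestronglyMeasurable
  · filter_upwards [ae_mollMeasure_mem_ball n] with y hy
    have h1 := hball y (Metric.ball_subset_ball hn.le hy)
    refine le_trans (le_of_eq (eLpNorm_congr_ae ?_)) h1
    have h2 := (measurePreserving_sub_right (volume : Measure Space) y).quasiMeasurePreserving.ae_eq
      hgg'
    filter_upwards [hgg', h2] with x hx hx2
    simp only [Function.comp_apply] at hx2
    rw [hx, hx2]

/-- Mollification hardly changes a function that hardly varies near the point. -/
lemma abs_mollify_sub_le {g : Space → ℝ} (hg : LocallyIntegrable g) {n : ℕ} {x : Space}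
    {c δ : ℝ} (h : ∀ y ∈ Metric.ball x (mollBump n).rOut, |g y - c| ≤ δ) :
    |mollify n g x - c| ≤ δ := by
  have e : mollify n g x - c = ∫ y, (g (x - y) - c) ∂mollMeasure n := by
    rw [mollify_eq_integral, integral_sub (integrable_mollMeasure hg n x) (integrable_const _)]
    simp
  rw [e, ← Real.norm_eq_abs]
  refine (norm_integral_le_of_norm_le_const (C := δ) ?_).trans (by simp)
  filter_upwards [ae_mollMeasure_mem_ball n] with y hy
  rw [Real.norm_eq_abs]
  refine h _ ?_
  simpa [dist_eq_norm] using hy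

/-! ### Jets of classically differentiable functions -/

/-- The coordinate `x^α` as a continuous linear form. -/
noncomputable def coordL (α : Fin 4) : Spacetime →L[ℝ] ℝ :=
  Fin.cases (motive := fun _ => Spacetime →L[ℝ] ℝ) (ContinuousLinearMap.fst ℝ ℝ Space)
    (fun i => (EuclideanSpace.proj i : Space →L[ℝ] ℝ).comp (ContinuousLinearMap.snd ℝ ℝ Space)) α

lemma coordL_apply (α : Fin 4) (v : Spacetime) : coordL α v = coord α v := by
  refine Fin.cases ?_ (fun i => ?_) α <;> rfl

lemma coe_coordL (α : Fin 4) : ⇑(coordL α) = coord α := funext (coordL_apply α)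

/-- The covector on `ℝ⁴` with components `c`. -/
noncomputable def stCovec (c : Fin 4 → ℝ) : Spacetime →L[ℝ] ℝ := ∑ α, c α • coordL α

lemma stCovec_apply (c : Fin 4 → ℝ) (v : Spacetime) : stCovec c v = ∑ α, c α * coord α v := by
  simp [stCovec, coordL_apply]

lemma coord_frame (α β : Fin 4) : coord α (frame β) = if α = β then 1 else 0 := by
  refine Fin.cases ?_ (fun i => ?_) α <;> refine Fin.cases ?_ (fun j => ?_) β
  · simp [coord, frame]
  · simp [coord, frame, (Fin.succ_ne_zero j).symm]
  · simp [coord, frame]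
  · simp [coord, frame]

lemma stCovec_frame (c : Fin 4 → ℝ) (α : Fin 4) : stCovec c (frame α) = c α := by
  simp [stCovec_apply, coord_frame]

lemma stCovec_eq_coprod (c : Fin 4 → ℝ) : stCovec c
    = (ContinuousLinearMap.toSpanSingleton ℝ (c 0)).coprod (covec fun i => c i.succ) := by
  ext1
  · ext
    rw [ContinuousLinearMap.comp_apply, stCovec_apply, Fin.sum_univ_succ]
    simp [coord]
  · ext v
    rw [ContinuousLinearMap.comp_apply, stCovec_apply, Fin.sum_univ_succ]
    simp [coord, covec_apply]

lemma isOpen_slab (T : ℝ) : IsOpen (slab T) := isOpen_Ioo.preimage continuous_fst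

/-- `J` consists, up to order `k`, of the classical derivatives of the `C^k` function `J []` on the
slab. -/
structure IsClassicalJet (k : ℕ) (T : ℝ) (J : Jet) : Prop where
  hasFDerivAt : ∀ a : List (Fin 4), a.length < k → ∀ p ∈ slab T,
    HasFDerivAt (J a) (stCovec fun α => J (α :: a) p) p
  continuousOn : ∀ a : List (Fin 4), a.length ≤ k → ContinuousOn (J a) (slab T)

namespace IsClassicalJet

variable {k : ℕ} {T : ℝ} {J : Jet}

lemma pd_eq (h : IsClassicalJet k T J) {a : List (Fin 4)} (ha : a.length < k) {p : Spacetime}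
    (hp : p ∈ slab T) (α : Fin 4) : pd α (J a) p = J (α :: a) p := by
  rw [pd, (h.hasFDerivAt a ha p hp).fderiv, stCovec_frame]

lemma contDiffOn (h : IsClassicalJet k T J) {m : ℕ} {a : List (Fin 4)} (ha : m + a.length ≤ k) :
    ContDiffOn ℝ m (J a) (slab T) := by
  induction m generalizing a with
  | zero => exact contDiffOn_zero.2 (h.continuousOn a (by omega))
  | succ m ih =>
    have hd : ∀ p ∈ slab T, HasFDerivAt (J a) (stCovec fun α => J (α :: a) p) p :=
      h.hasFDerivAt a (by omega)
    rw [Nat.cast_add, Nat.cast_one, contDiffOn_succ_iff_fderiv_of_isOpen (isOpen_slab T)]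
    refine ⟨fun p hp => (hd p hp).differentiableAt.differentiableWithinAt, by simp, ?_⟩
    refine ContDiffOn.congr (f := fun p => stCovec fun α => J (α :: a) p) ?_
      fun p hp => (hd p hp).fderiv
    exact ContDiffOn.sum fun α _ =>
      (ih (a := α :: a) (by simp; omega)).smul contDiffOn_const

/-- The derivatives of a `C^k` function commute. -/
lemma symmAt (h : IsClassicalJet k T J) {p : Spacetime} (hp : p ∈ slab T) : SymmAt k p J := by
  intro a b hab
  induction hab generalizing p with
  | nil => intro _; rfl
  | @cons x a b hab ih =>
    intro ha
    have ha' : a.length < k := by simpa using ha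
    rw [← h.pd_eq ha' hp, ← h.pd_eq (hab.length_eq ▸ ha') hp]
    have : J a =ᶠ[𝓝 p] J b := by
      filter_upwards [(isOpen_slab T).mem_nhds hp] with p' hp'
      exact ih hp' ha'.le
    rw [pd, pd, this.fderiv_eq]
  | swap x y l =>
    intro ha
    have ha' : l.length + 1 < k := by simp only [List.length_cons] at ha; omega
    have h1 : ∀ᶠ p' in 𝓝 p, HasFDerivAt (J l) (stCovec fun α => J (α :: l) p') p' := by
      filter_upwards [(isOpen_slab T).mem_nhds hp] with p' hp'
      exact h.hasFDerivAt l (by omega) p' hp'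
    have h2 : HasFDerivAt (fun p' => stCovec fun α => J (α :: l) p')
        (∑ α, (stCovec fun β => J (β :: α :: l) p).smulRight (coordL α)) p := by
      refine HasFDerivAt.fun_sum fun α _ => ?_
      exact (h.hasFDerivAt (α :: l) (by simpa using ha') p hp).smul_const (coordL α)
    have h3 := second_derivative_symmetric_of_eventually h1 h2 (frame y) (frame x)
    simpa [stCovec_frame, coordL_apply, coord_frame] using h3
  | trans hab _ ih₁ ih₂ =>
    intro ha
    rw [ih₁ hp ha, ih₂ hp (by rwa [← hab.length_eq])]

lemma jetD (h : IsClassicalJet (k + 1) T J) (α : Fin 4) :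
    IsClassicalJet k T (jetD α J) where
  hasFDerivAt a ha p hp := h.hasFDerivAt (a ++ [α]) (by simpa using ha) p hp
  continuousOn a ha := h.continuousOn (a ++ [α]) (by simpa using ha)

lemma mono {m : ℕ} (h : IsClassicalJet k T J) (hm : m ≤ k) : IsClassicalJet m T J where
  hasFDerivAt a ha := h.hasFDerivAt a (by omega)
  continuousOn a ha := h.continuousOn a (by omega)

lemma jetX (h : IsClassicalJet k T J) (β : Fin 4) : IsClassicalJet k T (jetX β J) where
  hasFDerivAt a ha p hp := by
    have h1 : HasFDerivAt (fun p => coord β p) (coordL β) p := by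
      simpa only [coe_coordL] using (coordL β).hasFDerivAt (x := p)
    have hk : ∀ k : Fin a.length, HasFDerivAt
        (fun p => if a.get k = β then J (a.eraseIdx k) p else 0)
        (stCovec fun α => if a.get k = β then J (α :: a.eraseIdx k) p else 0) p := by
      intro j
      split_ifs with hj
      · exact h.hasFDerivAt _ ((List.length_eraseIdx_le a j).trans_lt ha) p hp
      · have : (stCovec fun _ => (0 : ℝ)) = 0 := by simp [stCovec]
        rw [this]
        exact hasFDerivAt_const _ _
    refine ((h1.mul (h.hasFDerivAt a ha p hp)).add
      (HasFDerivAt.fun_sum (u := Finset.univ) fun j _ => hk j)).congr_fderiv ?_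
    refine ContinuousLinearMap.ext fun v => ?_
    have e1 : ∀ α, EinsteinMaxwell.jetX β J (α :: a) p = coord β p * J (α :: a) p
        + (∑ k : Fin a.length, if a.get k = β then J (α :: a.eraseIdx k) p else 0)
        + if α = β then J a p else 0 := fun α => jetX_cons β α J a p
    simp only [add_apply, smul_apply, sum_apply,
      stCovec_apply, e1, coordL_apply, smul_eq_mul, add_mul, Finset.sum_add_distrib, ite_mul,
      zero_mul, Finset.sum_ite_eq', Finset.mem_univ, if_true, Finset.mul_sum, Finset.sum_mul]
    rw [Finset.sum_comm]
    simp only [mul_assoc]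
    ring
  continuousOn a ha := by
    refine ContinuousOn.add (ContinuousOn.mul ?_ (h.continuousOn a ha))
      (continuousOn_finsetSum _ fun j _ => ?_)
    · simpa only [coe_coordL] using (coordL β).continuous.continuousOn (s := slab T)
    · split_ifs
      · exact h.continuousOn _ ((List.length_eraseIdx_le a j).trans ha)
      · exact continuousOn_const

lemma add {J' : Jet} (h : IsClassicalJet k T J) (h' : IsClassicalJet k T J') :
    IsClassicalJet k T (J + J') where
  hasFDerivAt a ha p hp := by
    refine ((h.hasFDerivAt a ha p hp).add (h'.hasFDerivAt a ha p hp)).congr_fderiv ?_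
    simp [stCovec, add_smul, Finset.sum_add_distrib]
  continuousOn a ha := (h.continuousOn a ha).add (h'.continuousOn a ha)

lemma const_smul (h : IsClassicalJet k T J) (c : ℝ) : IsClassicalJet k T (c • J) where
  hasFDerivAt a ha p hp := by
    refine ((h.hasFDerivAt a ha p hp).const_smul c).congr_fderiv ?_
    simp [stCovec, mul_smul, Finset.smul_sum]
  continuousOn a ha := (h.continuousOn a ha).const_smul c

lemma applyZ (h : IsClassicalJet (k + 1) T J) (Z : ZField) :
    IsClassicalJet k T (applyZ EinsteinMaxwell.jetD EinsteinMaxwell.jetX Z J) := by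
  rcases Z with α | s | _
  · exact h.jetD α
  · simp only [EinsteinMaxwell.applyZ, ← neg_smul]
    exact (((h.jetD _).jetX _).const_smul _).add (((h.jetD _).jetX _).const_smul _)
  · simp only [EinsteinMaxwell.applyZ, Fin.sum_univ_four]
    exact ((((h.jetD _).jetX _).add ((h.jetD _).jetX _)).add ((h.jetD _).jetX _)).add
      ((h.jetD _).jetX _)

lemma jetZ (I : List ZField) (h : IsClassicalJet (k + I.length) T J) :
    IsClassicalJet k T (jetZ I J) := by
  induction I generalizing k with
  | nil => exact h
  | cons Z I ih =>
    exact (ih (k := k + 1) (h.mono (by simp; omega))).applyZ Z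

/-- For a `C^k` function the classical `Z^I u` is computed by the formal action on its jet. -/
lemma Zc_eq (h : IsClassicalJet k T J) {I : List ZField} (hI : I.length ≤ k) {p : Spacetime}
    (hp : p ∈ slab T) : Zc I (J []) p = EinsteinMaxwell.jetZ I J [] p := by
  induction I generalizing p with
  | nil => rfl
  | cons Z I ih =>
    have hI' : I.length + 1 ≤ k := by simpa using hI
    have hc : IsClassicalJet 1 T (EinsteinMaxwell.jetZ I J) := jetZ I (h.mono (by omega))
    have hpd : ∀ α, pd α (Zc I (J [])) p = EinsteinMaxwell.jetZ I J [α] p := by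
      intro α
      rw [← hc.pd_eq (a := []) (by simp) hp α]
      have : Zc I (J []) =ᶠ[𝓝 p] EinsteinMaxwell.jetZ I J [] := by
        filter_upwards [(isOpen_slab T).mem_nhds hp] with p' hp'
        exact ih (by omega) hp'
      rw [pd, pd, this.fderiv_eq]
    change EinsteinMaxwell.applyZ pd mulCoord Z (Zc I (J [])) p
      = EinsteinMaxwell.applyZ _ _ Z (EinsteinMaxwell.jetZ I J) [] p
    rcases Z with α | s | _
    · exact hpd α
    · simp only [EinsteinMaxwell.applyZ, Pi.add_apply, Pi.neg_apply, Pi.smul_apply, mulCoord, hpd,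
        jetX_nil]
      rfl
    · simp only [EinsteinMaxwell.applyZ, Finset.sum_apply, mulCoord, hpd, jetX_nil]
      rfl

lemma pd_Zc_eq (h : IsClassicalJet k T J) {I : List ZField} (hI : I.length < k) {p : Spacetime}
    (hp : p ∈ slab T) (α : Fin 4) :
    pd α (Zc I (J [])) p = EinsteinMaxwell.jetZ I J [α] p := by
  have hc : IsClassicalJet 1 T (EinsteinMaxwell.jetZ I J) := jetZ I (h.mono (by omega))
  rw [← hc.pd_eq (a := []) (by simp) hp α]
  have : Zc I (J []) =ᶠ[𝓝 p] EinsteinMaxwell.jetZ I J [] := by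
    filter_upwards [(isOpen_slab T).mem_nhds hp] with p' hp'
    exact h.Zc_eq hI.le hp'
  rw [pd, pd, this.fderiv_eq]

/-- The restriction of a classical jet to a time slice. -/
lemma hasFDerivAt_slice (h : IsClassicalJet k T J) {a : List (Fin 4)} (ha : a.length < k) {t : ℝ}
    (ht : t ∈ Set.Ioo (-T) T) (x : Space) :
    HasFDerivAt (fun x => J a (t, x)) (covec fun i => J (i.succ :: a) (t, x)) x := by
  have h1 : HasFDerivAt (fun x : Space => (t, x)) (ContinuousLinearMap.inr ℝ ℝ Space) x :=
    hasFDerivAt_prodMk_right t x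
  refine ((h.hasFDerivAt a ha (t, x) ht).comp x h1).congr_fderiv ?_
  rw [stCovec_eq_coprod]
  ext v
  simp

lemma continuous_slice (h : IsClassicalJet k T J) {a : List (Fin 4)} (ha : a.length ≤ k) {t : ℝ}
    (ht : t ∈ Set.Ioo (-T) T) : Continuous fun x => J a (t, x) :=
  (h.continuousOn a ha).comp_continuous (by fun_prop) fun _ => ht

end IsClassicalJet

/-- Locally uniform convergence on the slab. -/
def TendstoLocUnif (T : ℝ) (f : ℕ → Spacetime → ℝ) (g : Spacetime → ℝ) : Prop :=
  ∀ p ∈ slab T, Tendsto (fun q : ℕ × Spacetime => f q.1 q.2 - g q.2) (atTop ×ˢ 𝓝 p) (𝓝 0)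

lemma tendstoUniformlyOnFilter_of_sub {E F : Type*} [NormedAddCommGroup F] {f : ℕ → E → F}
    {g : E → F} {l : Filter E}
    (h : Tendsto (fun q : ℕ × E => f q.1 q.2 - g q.2) (atTop ×ˢ l) (𝓝 0)) :
    TendstoUniformlyOnFilter f g atTop l := by
  rw [tendstoUniformlyOnFilter_iff_tendsto, uniformity_eq_comap_nhds_zero, tendsto_comap_iff]
  exact h

lemma TendstoLocUnif.tendsto {T : ℝ} {f : ℕ → Spacetime → ℝ} {g : Spacetime → ℝ}
    (h : TendstoLocUnif T f g) {p : Spacetime} (hp : p ∈ slab T) :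
    Tendsto (fun n => f n p) atTop (𝓝 (g p)) := by
  have h1 : Tendsto (fun n : ℕ => (n, p)) atTop (atTop ×ˢ 𝓝 p) :=
    tendsto_id.prodMk tendsto_const_nhds
  exact tendsto_sub_nhds_zero_iff.1 ((h p hp).comp h1)

/-- Classical jets are closed under locally uniform convergence. -/
theorem isClassicalJet_of_tendsto {k : ℕ} {T : ℝ} {U : ℕ → Jet} {V : Jet}
    (hU : ∀ n, IsClassicalJet k T (U n))
    (h : ∀ a : List (Fin 4), a.length ≤ k → TendstoLocUnif T (fun n => U n a) (V a)) :
    IsClassicalJet k T V where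
  hasFDerivAt a ha p hp := by
    have hV : HasFDerivAt (V a) ((fun p => stCovec fun α => V (α :: a) p) p) p := by
      refine hasFDerivAt_of_tendstoUniformlyOnFilter (l := (atTop : Filter ℕ)) (𝕜 := ℝ)
        (g := V a) (g' := fun p => stCovec fun α => V (α :: a) p) (x := p)
        (f := fun n => U n a) (f' := fun n p => stCovec fun α => U n (α :: a) p) ?_ ?_ ?_
      · refine tendstoUniformlyOnFilter_of_sub ?_
        have : Tendsto (fun q : ℕ × Spacetime =>
            ∑ α, (U q.1 (α :: a) q.2 - V (α :: a) q.2) • coordL α) (atTop ×ˢ 𝓝 p)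
            (𝓝 (∑ α : Fin 4, (0 : ℝ) • coordL α)) :=
          tendsto_finsetSum _ fun α _ => (h (α :: a) (by simpa using ha) p hp).smul_const _
        simp only [zero_smul, Finset.sum_const_zero] at this
        refine this.congr fun q => ?_
        simp only [stCovec]
        rw [← Finset.sum_sub_distrib]
        exact Finset.sum_congr rfl fun α _ => sub_smul _ _ _
      · have : ∀ᶠ q : ℕ × Spacetime in atTop ×ˢ 𝓝 p, q.2 ∈ slab T :=
          tendsto_snd.eventually ((isOpen_slab T).mem_nhds hp)
        filter_upwards [this] with q hq
        exact (hU q.1).hasFDerivAt a ha q.2 hq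
      · filter_upwards [(isOpen_slab T).mem_nhds hp] with p' hp'
        exact (h a ha.le).tendsto hp'
    exact hV
  continuousOn a ha := by
    refine TendstoLocallyUniformlyOn.continuousOn (F := fun n => U n a) (p := atTop)
      (tendstoLocallyUniformlyOn_iff_filter.2 fun p hp => ?_)
      (Frequently.of_forall fun n => (hU n).continuousOn a ha)
    exact tendstoUniformlyOnFilter_of_sub ((h a ha p hp).mono_left
      (Filter.prod_mono le_rfl nhdsWithin_le_nhds))

/-! ### Mollification of Sobolev jets and classical regularity -/

/-- The jet mollified in the space variables. -/
noncomputable def mollJet (n : ℕ) (J : Jet) : Jet := fun a p =>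
  mollify n (fun y => J a (p.1, y)) p.2

namespace IsSobolevJet

variable {s : ℕ} {T : ℝ} {u : Spacetime → ℝ} {J : Jet}

lemma locallyIntegrable (h : IsSobolevJet s T u J) {a : List (Fin 4)} (ha : a.length ≤ s) {t : ℝ}
    (ht : t ∈ Set.Ioo (-T) T) : LocallyIntegrable fun x : Space => J a (t, x) := by
  rcases eq_or_ne a [] with rfl | ha0
  · rw [h.zeroth]
    have : Continuous fun x : Space => u (t, x) :=
      h.continuousOn.comp_continuous (by fun_prop) fun _ => ht
    exact this.locallyIntegrable
  · exact (h.memLp a ha0 ha t ht).locallyIntegrable (by norm_num)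

lemma aestronglyMeasurable (h : IsSobolevJet s T u J) {a : List (Fin 4)} (ha : a.length ≤ s) {t : ℝ}
    (ht : t ∈ Set.Ioo (-T) T) : AEStronglyMeasurable fun x : Space => J a (t, x) :=
  (h.locallyIntegrable ha ht).aestronglyMeasurable

lemma aestronglyMeasurable_sub (h : IsSobolevJet s T u J) {a : List (Fin 4)} (ha : a.length ≤ s)
    {t τ : ℝ} (ht : t ∈ Set.Ioo (-T) T) (hτ : τ ∈ Set.Ioo (-T) T) :
    AEStronglyMeasurable fun x : Space => J a (τ, x) - J a (t, x) :=
  (h.aestronglyMeasurable ha hτ).sub (h.aestronglyMeasurable ha ht)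

lemma hasFDerivAt_mollJet_space (h : IsSobolevJet s T u J) {a : List (Fin 4)} (ha : a.length < s)
    {t : ℝ} (ht : t ∈ Set.Ioo (-T) T) (n : ℕ) (x : Space) :
    HasFDerivAt (fun x => mollJet n J a (t, x)) (covec fun i => mollJet n J (i.succ :: a) (t, x)) x :=
  hasFDerivAt_mollify (h.locallyIntegrable ha.le ht) (h.space_deriv a ha t ht) n x

/-- Pairing with the mollifier turns the derivative of an `L²`-valued function of time into a
pointwise derivative, by the Cauchy–Schwarz inequality. -/
lemma hasDerivAt_mollJet_time (h : IsSobolevJet s T u J) {a : List (Fin 4)} (ha : a.length < s)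
    {t : ℝ} (ht : t ∈ Set.Ioo (-T) T) (n : ℕ) (x : Space) :
    HasDerivAt (fun t => mollJet n J a (t, x)) (mollJet n J (0 :: a) (t, x)) t := by
  rw [hasDerivAt_iff_tendsto_slope, ← tendsto_sub_nhds_zero_iff,
    tendsto_zero_iff_enorm_tendsto_zero]
  have h0 : (0 :: a).length ≤ s := by simpa using ha
  have hlim : Tendsto (fun τ => eLpNorm (mollifier n) 2 * eLpNorm (fun x : Space =>
      (τ - t)⁻¹ * (J a (τ, x) - J a (t, x)) - J (0 :: a) (t, x)) 2 volume) (𝓝[≠] t) (𝓝 0) := by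
    simpa using ENNReal.Tendsto.const_mul (h.time_deriv a ha t ht)
      (Or.inr (eLpNorm_mollifier_ne_top n))
  refine tendsto_of_tendsto_of_tendsto_of_le_of_le' tendsto_const_nhds hlim
    (Eventually.of_forall fun _ => zero_le) ?_
  have hmem : ∀ᶠ τ in 𝓝[≠] t, τ ∈ Set.Ioo (-T) T :=
    nhdsWithin_le_nhds (isOpen_Ioo.mem_nhds ht)
  filter_upwards [hmem] with τ hτ
  have e : slope (fun t => mollJet n J a (t, x)) t τ - mollJet n J (0 :: a) (t, x)
      = mollify n (fun x => (τ - t)⁻¹ * (J a (τ, x) - J a (t, x)) - J (0 :: a) (t, x)) x := by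
    have hL := h.locallyIntegrable ha.le ht
    have hLτ := h.locallyIntegrable ha.le hτ
    rw [mollify_sub (g := fun x => (τ - t)⁻¹ * (J a (τ, x) - J a (t, x))) ?_
      (h.locallyIntegrable h0 ht), mollify_const_mul, mollify_sub hLτ hL, slope_def_field,
      div_eq_inv_mul]
    · rfl
    · exact (hLτ.sub hL).smul (τ - t)⁻¹
  rw [e]
  refine enorm_mollify_le ?_ n x
  exact ((h.aestronglyMeasurable_sub ha.le ht hτ).const_mul _).sub (h.aestronglyMeasurable h0 ht)

lemma continuousAt_mollJet (h : IsSobolevJet s T u J) {a : List (Fin 4)} (ha0 : a ≠ [])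
    (ha : a.length ≤ s) (n : ℕ) {p : Spacetime} (hp : p ∈ slab T) :
    ContinuousAt (mollJet n J a) p := by
  have h1 : Tendsto (fun p' : Spacetime => mollJet n J a p' - mollJet n J a (p.1, p'.2)) (𝓝 p)
      (𝓝 0) := by
    rw [tendsto_zero_iff_enorm_tendsto_zero]
    have hlim : Tendsto (fun p' : Spacetime => eLpNorm (mollifier n) 2
        * eLpNorm (fun x : Space => J a (p'.1, x) - J a (p.1, x)) 2 volume) (𝓝 p) (𝓝 0) := by
      simpa using ENNReal.Tendsto.const_mul ((h.continuous_time a ha0 ha p.1 hp).comp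
        (continuous_fst.tendsto p)) (Or.inr (eLpNorm_mollifier_ne_top n))
    refine tendsto_of_tendsto_of_tendsto_of_le_of_le' tendsto_const_nhds hlim
      (Eventually.of_forall fun _ => zero_le) ?_
    filter_upwards [(isOpen_slab T).mem_nhds hp] with p' hp'
    have e : mollJet n J a p' - mollJet n J a (p.1, p'.2)
        = mollify n (fun x => J a (p'.1, x) - J a (p.1, x)) p'.2 :=
      (mollify_sub (h.locallyIntegrable ha hp') (h.locallyIntegrable ha hp) n p'.2).symm
    rw [e]
    exact enorm_mollify_le (h.aestronglyMeasurable_sub ha hp hp') n p'.2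
  have h2 : Tendsto (fun p' : Spacetime => mollJet n J a (p.1, p'.2)) (𝓝 p)
      (𝓝 (mollJet n J a (p.1, p.2))) :=
    ((continuous_mollify (h.locallyIntegrable ha hp) n).comp continuous_snd).tendsto p
  have h3 := h1.add h2
  simp only [sub_add_cancel, zero_add] at h3
  exact h3

theorem isClassicalJet_mollJet (h : IsSobolevJet (s + 1) T u J) (n : ℕ) :
    IsClassicalJet (s + 1) T (mollJet n J) := by
  have hd : ∀ a : List (Fin 4), a.length < s + 1 → ∀ p ∈ slab T,
      HasFDerivAt (mollJet n J a) (stCovec fun α => mollJet n J (α :: a) p) p := by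
    intro a ha p hp
    have hev : ∀ᶠ p' in 𝓝 p, p' ∈ slab T := (isOpen_slab T).mem_nhds hp
    have hc : ∀ α, ContinuousAt (mollJet n J (α :: a)) p := fun α =>
      h.continuousAt_mollJet (by simp) (by simpa using ha) n hp
    have := (hasStrictFDerivAt_uncurry_coprod (𝕜 := ℝ) (u := p)
      (f := fun t x => mollJet n J a (t, x))
      (f₁ := fun t x => ContinuousLinearMap.toSpanSingleton ℝ (mollJet n J (0 :: a) (t, x)))
      (f₂ := fun t x => covec fun i => mollJet n J (i.succ :: a) (t, x)) ?_ ?_ ?_ ?_).hasFDerivAt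
    · rw [stCovec_eq_coprod]
      exact this
    · filter_upwards [hev] with v hv
      exact (h.hasDerivAt_mollJet_time ha hv n v.2).hasFDerivAt
    · filter_upwards [hev] with v hv
      exact h.hasFDerivAt_mollJet_space ha hv n v.2
    · exact (ContinuousLinearMap.toSpanSingletonCLE (𝕜 := ℝ) (E := ℝ)).continuous.continuousAt.comp
        (hc 0)
    · have hs : Tendsto (fun p' => ∑ i : Fin 3, mollJet n J (i.succ :: a) p'
          • (EuclideanSpace.proj i : Space →L[ℝ] ℝ)) (𝓝 p)
          (𝓝 (∑ i : Fin 3, mollJet n J (i.succ :: a) p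
            • (EuclideanSpace.proj i : Space →L[ℝ] ℝ))) :=
        tendsto_finsetSum _ fun i _ => Filter.Tendsto.smul_const (hc i.succ) _
      exact hs
  refine ⟨hd, fun a ha p hp => ContinuousAt.continuousWithinAt ?_⟩
  rcases eq_or_ne a [] with rfl | ha0
  · exact (hd [] (by simp) p hp).continuousAt
  · exact h.continuousAt_mollJet ha0 ha n hp

lemma tendsto_eLpNorm_mollJet_sub (h : IsSobolevJet s T u J) {a : List (Fin 4)} (ha0 : a ≠ [])
    (ha : a.length ≤ s) {t : ℝ} (ht : t ∈ Set.Ioo (-T) T) :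
    Tendsto (fun q : ℕ × ℝ =>
      eLpNorm (fun x : Space => mollJet q.1 J a (q.2, x) - J a (q.2, x)) 2 volume)
      (atTop ×ˢ 𝓝 t) (𝓝 0) := by
  have h1 := (h.continuous_time a ha0 ha t ht).comp (tendsto_snd (f := (atTop : Filter ℕ)))
  have h2 := (tendsto_eLpNorm_mollify_sub (h.memLp a ha0 ha t ht)).comp
    (tendsto_fst (g := 𝓝 t))
  have h3 := (h1.add h2).add h1
  simp only [add_zero] at h3
  refine tendsto_of_tendsto_of_tendsto_of_le_of_le' tendsto_const_nhds h3
    (Eventually.of_forall fun _ => zero_le) ?_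
  have hmem : ∀ᶠ q : ℕ × ℝ in atTop ×ˢ 𝓝 t, q.2 ∈ Set.Ioo (-T) T :=
    tendsto_snd.eventually (isOpen_Ioo.mem_nhds ht)
  filter_upwards [hmem] with q hq
  have hL := h.locallyIntegrable ha ht
  have hLq := h.locallyIntegrable ha hq
  have hm := h.aestronglyMeasurable_sub ha ht hq
  have e : (fun x : Space => mollJet q.1 J a (q.2, x) - J a (q.2, x))
      = (mollify q.1 (fun x => J a (q.2, x) - J a (t, x))
        + fun x => mollify q.1 (fun x => J a (t, x)) x - J a (t, x))
        - fun x => J a (q.2, x) - J a (t, x) := by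
    ext x
    simp only [Pi.add_apply, Pi.sub_apply]
    rw [mollify_sub hLq hL]
    simp only [mollJet]
    ring
  have hm1 := (continuous_mollify (hLq.sub hL) q.1).aestronglyMeasurable
    (μ := (volume : Measure Space))
  have hm2 := ((continuous_mollify hL q.1).aestronglyMeasurable
    (μ := (volume : Measure Space))).sub (h.aestronglyMeasurable ha ht)
  rw [e]
  refine (eLpNorm_sub_le (hm1.add hm2) hm (by norm_num)).trans (add_le_add_left ?_ _)
  refine (eLpNorm_add_le hm1 hm2 (by norm_num)).trans (add_le_add_left ?_ _)
  exact eLpNorm_mollify_le hm q.1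

lemma tendstoLocUnif_mollJet_nil (h : IsSobolevJet s T u J) :
    TendstoLocUnif T (fun n => mollJet n J []) u := by
  intro p hp
  rw [Metric.tendsto_nhds]
  intro δ hδ
  have hc : ContinuousAt u p := h.continuousOn.continuousAt ((isOpen_slab T).mem_nhds hp)
  obtain ⟨r, hr, hball⟩ := Metric.eventually_nhds_iff_ball.1
    ((Metric.tendsto_nhds.1 hc (δ / 4) (by positivity)).and ((isOpen_slab T).mem_nhds hp))
  have h1 : ∀ᶠ q : ℕ × Spacetime in atTop ×ˢ 𝓝 p, (mollBump q.1).rOut < r / 2 :=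
    tendsto_fst.eventually (tendsto_rOut_mollBump.eventually (gt_mem_nhds (by positivity)))
  have h2 : ∀ᶠ q : ℕ × Spacetime in atTop ×ˢ 𝓝 p, q.2 ∈ Metric.ball p (r / 2) :=
    tendsto_snd.eventually (Metric.ball_mem_nhds p (by positivity))
  filter_upwards [h1, h2] with q hq1 hq2
  have hq : q.2 ∈ Metric.ball p r := Metric.ball_subset_ball (by linarith) hq2
  have hqp := (hball q.2 hq).1
  have := abs_mollify_sub_le (n := q.1) (x := q.2.2) (c := u q.2) (δ := δ / 2)
    (h.locallyIntegrable (a := []) (by simp) (hball q.2 hq).2) ?_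
  · rw [Real.dist_eq, sub_zero]
    exact this.trans_lt (by linarith)
  · intro y hy
    have hy' : (q.2.1, y) ∈ Metric.ball p r := by
      rw [Metric.mem_ball] at hq2 hy ⊢
      have h4 : dist (q.2.1, y) q.2 ≤ dist y q.2.2 := by
        rw [Prod.dist_eq]; simp
      linarith [dist_triangle (q.2.1, y) q.2 p]
    have h5 := (hball _ hy').1
    rw [h.zeroth, ← Real.dist_eq]
    have := dist_triangle_right (u (q.2.1, y)) (u q.2) (u p)
    linarith

/-- The mollified jets converge locally uniformly, up to two orders less than the order of the
Sobolev jet, by the embedding `H² ⊂ L^∞` on the time slices. The limit is a classical jet of `u`. -/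
theorem exists_isClassicalJet (h : IsSobolevJet (s + 2) T u J) :
    ∃ V : Jet, V [] = u ∧ IsClassicalJet s T V ∧ ∀ a : List (Fin 4), a.length ≤ s →
      ∀ p ∈ slab T, Tendsto (fun n => mollJet n J a p) atTop (𝓝 (V a p)) := by
  obtain ⟨S, hS, hsob⟩ := exists_sobolev_const
  have hU := fun n => h.isClassicalJet_mollJet n
  -- the distance of the mollified slice to the slice in `L²`
  let e : ℕ → ℝ → List (Fin 4) → ℝ≥0∞ := fun n t b =>
    eLpNorm (fun x : Space => mollJet n J b (t, x) - J b (t, x)) 2 volume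
  let E : List (Fin 4) → ℕ × ℝ → ℝ≥0∞ := fun a q => ENNReal.ofReal S * (e q.1 q.2 a
    + ∑ i : Fin 3, e q.1 q.2 (i.succ :: a)
    + ∑ i : Fin 3, ∑ j : Fin 3, e q.1 q.2 (j.succ :: i.succ :: a))
  have hE : ∀ a : List (Fin 4), a ≠ [] → a.length ≤ s → ∀ t ∈ Set.Ioo (-T) T,
      Tendsto (E a) (atTop ×ˢ 𝓝 t) (𝓝 0) := by
    intro a ha0 ha t ht
    have he : ∀ b : List (Fin 4), b ≠ [] → b.length ≤ s + 2 →
        Tendsto (fun q : ℕ × ℝ => e q.1 q.2 b) (atTop ×ˢ 𝓝 t) (𝓝 0) := fun b hb0 hb =>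
      h.tendsto_eLpNorm_mollJet_sub hb0 hb ht
    have h3 := ((he a ha0 (by omega)).add (tendsto_finsetSum Finset.univ fun i : Fin 3 => fun _ =>
      he (i.succ :: a) (by simp) (by simp; omega))).add
      (tendsto_finsetSum Finset.univ fun i : Fin 3 => fun _ =>
        tendsto_finsetSum Finset.univ fun j : Fin 3 => fun _ =>
        he (j.succ :: i.succ :: a) (by simp) (by simp; omega))
    simpa using ENNReal.Tendsto.const_mul h3 (Or.inr ENNReal.ofReal_ne_top)
  -- the Sobolev inequality with `ρ = 1` for the difference of two mollified jets
  have hpair : ∀ a : List (Fin 4), a ≠ [] → a.length ≤ s → ∀ p ∈ slab T, ∀ n m,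
      edist (mollJet n J a p) (mollJet m J a p) ≤ E a (n, p.1) + E a (m, p.1) := by
    intro a ha0 ha p hp n m
    have hW : IsClassicalJet (s + 2) T (mollJet n J + (-1 : ℝ) • mollJet m J) :=
      (hU n).add ((hU m).const_smul _)
    set W : Jet := mollJet n J + (-1 : ℝ) • mollJet m J with hWdef
    have hWb : ∀ b q, W b q = mollJet n J b q - mollJet m J b q := fun b q => by
      simp [hWdef, sub_eq_add_neg]
    have hm : ∀ b : List (Fin 4), b.length ≤ s + 2 →
        AEStronglyMeasurable (fun x : Space => |W b (p.1, x)|) volume := fun b hb =>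
      (hW.continuous_slice hb hp).abs.aestronglyMeasurable
    have hWe : ∀ b : List (Fin 4), b.length ≤ s + 2 →
        eLpNorm (fun x : Space => |W b (p.1, x)|) 2 volume ≤ e n p.1 b + e m p.1 b := by
      intro b hb
      have hJm := h.aestronglyMeasurable hb hp
      have e1 : eLpNorm (fun x : Space => |W b (p.1, x)|) 2 volume
          = eLpNorm ((fun x : Space => mollJet n J b (p.1, x) - J b (p.1, x))
            - fun x : Space => mollJet m J b (p.1, x) - J b (p.1, x)) 2 volume := by
        rw [show (fun x : Space => |W b (p.1, x)|) = fun x : Space => ‖W b (p.1, x)‖ from rfl,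
          eLpNorm_norm]
        congr 1
        ext x
        simp [hWb]
      rw [e1]
      refine eLpNorm_sub_le ?_ ?_ (by norm_num)
      · exact ((hU n).continuous_slice hb hp).aestronglyMeasurable.sub hJm
      · exact ((hU m).continuous_slice hb hp).aestronglyMeasurable.sub hJm
    have h1 := hsob (fun x => W a (p.1, x)) (fun i x => W (i.succ :: a) (p.1, x))
      (fun j i x => W (j.succ :: i.succ :: a) (p.1, x))
      (fun y => hW.hasFDerivAt_slice (by omega) hp y)
      (fun i y => hW.hasFDerivAt_slice (by simp; omega) hp y)
      (fun j i => hW.continuous_slice (by simp; omega) hp) 1 one_pos p.2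
      ((fun x : Space => |W a (p.1, x)|) + (∑ i : Fin 3, fun x : Space => |W (i.succ :: a) (p.1, x)|)
        + ∑ i : Fin 3, ∑ j : Fin 3, fun x : Space => |W (j.succ :: i.succ :: a) (p.1, x)|)
      (fun y _ => by simp)
    rw [Real.one_rpow, mul_one] at h1
    have h2 : edist (mollJet n J a p) (mollJet m J a p) = ENNReal.ofReal |W a (p.1, p.2)| := by
      rw [edist_dist, Real.dist_eq, hWb]
    rw [h2]
    refine h1.trans ?_
    rw [← mul_add]
    refine mul_le_mul_right ((eLpNorm_mono_measure _ Measure.restrict_le_self).trans ?_) _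
    have ha2 : ∀ i : Fin 3, (i.succ :: a).length ≤ s + 2 := fun i => by simp; omega
    have ha3 : ∀ i j : Fin 3, (j.succ :: i.succ :: a).length ≤ s + 2 := fun i j => by simp; omega
    have hm2 : AEStronglyMeasurable (∑ i : Fin 3, fun x : Space => |W (i.succ :: a) (p.1, x)|)
      volume := Finset.aestronglyMeasurable_sum _ fun i _ => hm _ (ha2 i)
    have hm3 : AEStronglyMeasurable
        (∑ i : Fin 3, ∑ j : Fin 3, fun x : Space => |W (j.succ :: i.succ :: a) (p.1, x)|)
      volume := Finset.aestronglyMeasurable_sum _ fun i _ =>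
        Finset.aestronglyMeasurable_sum _ fun j _ => hm _ (ha3 i j)
    have h4 : (e n p.1 a + ∑ i : Fin 3, e n p.1 (i.succ :: a)
        + ∑ i : Fin 3, ∑ j : Fin 3, e n p.1 (j.succ :: i.succ :: a))
        + (e m p.1 a + ∑ i : Fin 3, e m p.1 (i.succ :: a)
        + ∑ i : Fin 3, ∑ j : Fin 3, e m p.1 (j.succ :: i.succ :: a))
        = (e n p.1 a + e m p.1 a) + (∑ i : Fin 3, (e n p.1 (i.succ :: a) + e m p.1 (i.succ :: a)))
          + ∑ i : Fin 3, ∑ j : Fin 3,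
            (e n p.1 (j.succ :: i.succ :: a) + e m p.1 (j.succ :: i.succ :: a)) := by
      simp only [Finset.sum_add_distrib]
      ring
    refine le_trans ?_ (le_of_eq h4.symm)
    refine (eLpNorm_add_le ((hm _ (by omega)).add hm2) hm3 (by norm_num)).trans (add_le_add ?_ ?_)
    · refine (eLpNorm_add_le (hm _ (by omega)) hm2 (by norm_num)).trans
        (add_le_add (hWe a (by omega)) ?_)
      exact (eLpNorm_sum_le (fun i _ => hm _ (ha2 i)) (by norm_num)).trans
        (Finset.sum_le_sum fun i _ => hWe _ (ha2 i))
    · refine (eLpNorm_sum_le (fun i _ => Finset.aestronglyMeasurable_sum _ fun j _ =>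
        hm _ (ha3 i j)) (by norm_num)).trans (Finset.sum_le_sum fun i _ => ?_)
      exact (eLpNorm_sum_le (fun j _ => hm _ (ha3 i j)) (by norm_num)).trans
        (Finset.sum_le_sum fun j _ => hWe _ (ha3 i j))
  have hEp : ∀ a : List (Fin 4), a ≠ [] → a.length ≤ s → ∀ p ∈ slab T,
      Tendsto (fun n => E a (n, p.1)) atTop (𝓝 0) := fun a ha0 ha p hp =>
    (hE a ha0 ha p.1 hp).comp (tendsto_id.prodMk tendsto_const_nhds)
  have hlim : ∀ a : List (Fin 4), a ≠ [] → a.length ≤ s → ∀ p ∈ slab T,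
      Tendsto (fun n => mollJet n J a p) atTop (𝓝 (limUnder atTop fun n => mollJet n J a p)) := by
    intro a ha0 ha p hp
    refine CauchySeq.tendsto_limUnder (EMetric.cauchySeq_iff.2 fun δ hδ => ?_)
    have hδ2 : 0 < δ / 2 := ENNReal.half_pos hδ.ne'
    obtain ⟨k, hk⟩ := eventually_atTop.1 ((hEp a ha0 ha p hp).eventually (gt_mem_nhds hδ2))
    refine ⟨k, fun m hm n hn => (hpair a ha0 ha p hp m n).trans_lt ?_⟩
    calc _ < δ / 2 + δ / 2 := ENNReal.add_lt_add (hk m hm) (hk n hn)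
      _ = δ := ENNReal.add_halves δ
  -- `u` need not lie in `L²`, so its mollifications converge by the continuity of `u` instead
  classical
  let V : Jet := fun a p => if a = [] then u p else limUnder atTop fun n => mollJet n J a p
  have hV0 : V [] = u := by ext p; simp [V]
  have hLU : ∀ a : List (Fin 4), a.length ≤ s → TendstoLocUnif T (fun n => mollJet n J a) (V a) := by
    intro a ha
    rcases eq_or_ne a [] with rfl | ha0
    · rw [hV0]
      exact h.tendstoLocUnif_mollJet_nil
    · intro p hp
      have hVa : V a = fun p => limUnder atTop fun n => mollJet n J a p := by
        ext p; simp [V, ha0]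
      rw [tendsto_zero_iff_enorm_tendsto_zero]
      have h1 : Tendsto (fun q : ℕ × Spacetime => E a (q.1, q.2.1)) (atTop ×ˢ 𝓝 p) (𝓝 0) :=
        (hE a ha0 ha p.1 hp).comp (tendsto_fst.prodMk ((continuous_fst.tendsto p).comp tendsto_snd))
      refine tendsto_of_tendsto_of_tendsto_of_le_of_le' tendsto_const_nhds h1
        (Eventually.of_forall fun _ => zero_le) ?_
      have hmem : ∀ᶠ q : ℕ × Spacetime in atTop ×ˢ 𝓝 p, q.2 ∈ slab T :=
        tendsto_snd.eventually ((isOpen_slab T).mem_nhds hp)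
      filter_upwards [hmem] with q hq
      rw [← edist_eq_enorm_sub, hVa]
      have h2 : Tendsto (fun m => E a (q.1, q.2.1) + E a (m, q.2.1)) atTop
          (𝓝 (E a (q.1, q.2.1) + 0)) := tendsto_const_nhds.add (hEp a ha0 ha q.2 hq)
      rw [add_zero] at h2
      exact le_of_tendsto_of_tendsto (tendsto_const_nhds.edist (hlim a ha0 ha q.2 hq)) h2
        (Eventually.of_forall fun m => hpair a ha0 ha q.2 hq q.1 m)
  exact ⟨V, hV0, isClassicalJet_of_tendsto (fun n => (hU n).mono (by omega)) hLU,
    fun a ha p hp => (hLU a ha).tendsto hp⟩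

end IsSobolevJet

/-! ### Decay of one component -/

/-- A property of families of functions that is stable under linear combinations and under
multiplication by coordinates passes from a family of jets to the images under `Z^I`. Only proper
derivatives are involved, since every field of the family has order one. -/
lemma jetZ_induction {ι : Type*} {Q : (ι → Spacetime → ℝ) → Prop} (hzero : Q fun _ _ => 0)
    (hadd : ∀ f g, Q f → Q g → Q fun i p => f i p + g i p)
    (hsmul : ∀ (c : ℝ) f, Q f → Q fun i p => c * f i p)
    (hcoord : ∀ β f, Q f → Q fun i p => coord β p * f i p)
    {J : ι → Jet} (I : List ZField) {k : ℕ}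
    (h : ∀ a : List (Fin 4), a ≠ [] → a.length ≤ k + I.length → Q fun i => J i a)
    {a : List (Fin 4)} (ha0 : a ≠ []) (ha : a.length ≤ k) : Q fun i => jetZ I (J i) a := by
  induction I generalizing k a with
  | nil => exact h a ha0 (by simpa using ha)
  | cons Z I ih =>
    have hI : ∀ b : List (Fin 4), b ≠ [] → b.length ≤ k + 1 → Q fun i => jetZ I (J i) b :=
      fun b hb0 hb => ih (k := k + 1)
        (fun a ha0 ha => h a ha0 (by simp only [List.length_cons]; omega)) hb0 hb
    have hX : ∀ β γ, Q fun i => jetX β (jetD γ (jetZ I (J i))) a := by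
      intro β γ
      have hsum : ∀ s : Finset (Fin a.length), Q fun i p => ∑ k ∈ s,
          if a.get k = β then jetD γ (jetZ I (J i)) (a.eraseIdx k) p else 0 := by
        intro s
        induction s using Finset.induction_on with
        | empty => simpa using hzero
        | insert j s hj ihs =>
          simp only [Finset.sum_insert hj]
          refine hadd _ _ ?_ ihs
          split_ifs
          · refine hI (a.eraseIdx j ++ [γ]) (by simp) ?_
            have := List.length_eraseIdx_le a j
            simp only [List.length_append, List.length_cons, List.length_nil]
            omega
          · exact hzero
      exact hadd _ _ (hcoord β _ (hI (a ++ [γ]) (by simp) (by simpa using ha))) (hsum Finset.univ)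
    rcases Z with α | s | _
    · exact hI (a ++ [α]) (by simp) (by simpa using ha)
    · have e : (fun i => jetZ (Sum.inr (Sum.inl s) :: I) (J i) a) = fun i p =>
          (-1) * (mink s.1.1 * jetX s.1.1 (jetD s.1.2 (jetZ I (J i))) a p)
          + mink s.1.2 * jetX s.1.2 (jetD s.1.1 (jetZ I (J i))) a p := by
        ext i p
        change (-(mink s.1.1 • jetX s.1.1 (jetD s.1.2 (jetZ I (J i))))
          + mink s.1.2 • jetX s.1.2 (jetD s.1.1 (jetZ I (J i)))) a p = _
        simp
      rw [e]
      exact hadd _ _ (hsmul _ _ (hsmul _ _ (hX _ _))) (hsmul _ _ (hX _ _))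
    · have e : (fun i => jetZ (Sum.inr (Sum.inr ()) :: I) (J i) a) = fun i p =>
          ((jetX 0 (jetD 0 (jetZ I (J i))) a p + jetX 1 (jetD 1 (jetZ I (J i))) a p)
          + jetX 2 (jetD 2 (jetZ I (J i))) a p) + jetX 3 (jetD 3 (jetZ I (J i))) a p := by
        ext i p
        change (∑ α, jetX α (jetD α (jetZ I (J i)))) a p = _
        simp [Fin.sum_univ_four]
      rw [e]
      exact hadd _ _ (hadd _ _ (hadd _ _ (hX _ _) (hX _ _)) (hX _ _)) (hX _ _)

/-- Pointwise convergence of a sequence of jets passes to `Z^I`. In the family of jets that enters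
`jetZ_induction` the index `none` stands for the limit. -/
lemma tendsto_jetZ {U : ℕ → Jet} {V : Jet} {p : Spacetime} (I : List ZField) {k : ℕ}
    (h : ∀ a : List (Fin 4), a.length ≤ k + I.length → Tendsto (fun n => U n a p) atTop (𝓝 (V a p)))
    {a : List (Fin 4)} (ha0 : a ≠ []) (ha : a.length ≤ k) :
    Tendsto (fun n => jetZ I (U n) a p) atTop (𝓝 (jetZ I V a p)) := by
  refine jetZ_induction (ι := Option ℕ)
    (Q := fun f => Tendsto (fun n => f (some n) p) atTop (𝓝 (f none p))) tendsto_const_nhds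
    (fun f g hf hg => hf.add hg) (fun c f hf => hf.const_mul c) (fun β f hf => hf.const_mul _)
    (J := fun i => i.elim V U) I (fun a _ ha => h a ha) ha0 ha

lemma abs_coord_le (β : Fin 4) (p : Spacetime) : |coord β p| ≤ |p.1| + ‖p.2‖ := by
  refine Fin.cases ?_ (fun i => ?_) β
  · exact le_add_of_nonneg_right (norm_nonneg _)
  · exact (PiLp.norm_apply_le p.2 i).trans (le_add_of_nonneg_left (abs_nonneg _))

/-- Convergence in `L²` of the slices passes to `Z^I`, locally because the coordinates are unbounded.
The index `none` stands for the limit. -/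
lemma tendsto_eLpNorm_jetZ_sub {U : ℕ → Jet} {J : Jet} {t : ℝ} {x : Space} {ρ : ℝ}
    (I : List ZField) {k : ℕ}
    (hU : ∀ a : List (Fin 4), a ≠ [] → a.length ≤ k + I.length → ∀ n,
      AEStronglyMeasurable (fun y : Space => U n a (t, y)) volume)
    (hJ : ∀ a : List (Fin 4), a ≠ [] → a.length ≤ k + I.length →
      AEStronglyMeasurable (fun y : Space => J a (t, y)) volume)
    (h : ∀ a : List (Fin 4), a ≠ [] → a.length ≤ k + I.length →
      Tendsto (fun n => eLpNorm (fun y : Space => U n a (t, y) - J a (t, y)) 2 volume) atTop (𝓝 0))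
    {a : List (Fin 4)} (ha0 : a ≠ []) (ha : a.length ≤ k) :
    (∀ i : Option ℕ, AEStronglyMeasurable (fun y : Space => jetZ I (i.elim J U) a (t, y))
      (volume.restrict (Metric.ball x ρ))) ∧
    Tendsto (fun n => eLpNorm (fun y : Space => jetZ I (U n) a (t, y) - jetZ I J a (t, y)) 2
      (volume.restrict (Metric.ball x ρ))) atTop (𝓝 0) := by
  set ν := (volume : Measure Space).restrict (Metric.ball x ρ) with hν
  refine jetZ_induction (ι := Option ℕ)
    (Q := fun f => (∀ i, AEStronglyMeasurable (fun y : Space => f i (t, y)) ν) ∧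
      Tendsto (fun n => eLpNorm (fun y : Space => f (some n) (t, y) - f none (t, y)) 2 ν)
        atTop (𝓝 0)) ?_ ?_ ?_ ?_ (J := fun i => i.elim J U) I ?_ ha0 ha
  · exact ⟨fun _ => aestronglyMeasurable_const, by simp⟩
  · rintro f g ⟨hf, hf'⟩ ⟨hg, hg'⟩
    refine ⟨fun i => (hf i).add (hg i), ?_⟩
    have hlim := hf'.add hg'
    rw [add_zero] at hlim
    refine tendsto_of_tendsto_of_tendsto_of_le_of_le tendsto_const_nhds hlim (fun _ => zero_le)
      fun n => ?_
    refine le_trans (le_of_eq (congrArg (fun F => eLpNorm F 2 ν) ?_))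
      (eLpNorm_add_le ((hf (some n)).sub (hf none)) ((hg (some n)).sub (hg none)) (by norm_num))
    ext y
    simp only [Pi.add_apply]
    ring
  · rintro c f ⟨hf, hf'⟩
    refine ⟨fun i => (hf i).const_mul c, ?_⟩
    have hlim := ENNReal.Tendsto.const_mul hf' (Or.inr (ENNReal.ofReal_ne_top (r := |c|)))
    rw [mul_zero] at hlim
    refine tendsto_of_tendsto_of_tendsto_of_le_of_le tendsto_const_nhds hlim (fun _ => zero_le)
      fun n => ?_
    refine eLpNorm_le_mul_eLpNorm_of_ae_le_mul (Eventually.of_forall fun y => ?_) 2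
    rw [← mul_sub, norm_mul, Real.norm_eq_abs c]
  · rintro β f ⟨hf, hf'⟩
    have hc : Continuous fun y : Space => coord β (t, y) := by
      have : Continuous fun y : Space => coordL β (t, y) := by fun_prop
      simpa only [coordL_apply] using this
    refine ⟨fun i => hc.aestronglyMeasurable.mul (hf i), ?_⟩
    have hlim := ENNReal.Tendsto.const_mul hf'
      (Or.inr (ENNReal.ofReal_ne_top (r := |t| + (‖x‖ + ρ))))
    rw [mul_zero] at hlim
    refine tendsto_of_tendsto_of_tendsto_of_le_of_le tendsto_const_nhds hlim (fun _ => zero_le)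
      fun n => ?_
    refine eLpNorm_le_mul_eLpNorm_of_ae_le_mul ?_ 2
    filter_upwards [ae_restrict_mem measurableSet_ball] with y hy
    rw [← mul_sub, norm_mul]
    refine mul_le_mul_of_nonneg_right ((abs_coord_le β (t, y)).trans ?_) (norm_nonneg _)
    have h1 : ‖y - x‖ < ρ := by simpa [dist_eq_norm] using hy
    have h2 : ‖y‖ ≤ ‖x‖ + ‖y - x‖ := norm_le_norm_add_norm_sub' y x
    simp only [add_le_add_iff_left]
    linarith
  · intro b hb0 hb
    refine ⟨fun i => ?_, ?_⟩
    · rcases i with _ | n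
      · exact (hJ b hb0 hb).restrict
      · exact (hU b hb0 hb n).restrict
    · exact tendsto_of_tendsto_of_tendsto_of_le_of_le tendsto_const_nhds (h b hb0 hb)
        (fun _ => zero_le) fun n => eLpNorm_mono_measure _ Measure.restrict_le_self

/-- The sum `sumDZ k` has `4 · 12 ^ k` terms. -/
lemma eLpNorm_sumDZ_le {J : Jet} {t : ℝ} {ν : Measure Space} {M : ℝ≥0∞} (k : ℕ) (I : List ZField)
    (hm : ∀ L : List ZField, L.length ≤ k + I.length → ∀ β,
      AEStronglyMeasurable (fun y : Space => jetZ L J [β] (t, y)) ν)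
    (hM : ∀ L : List ZField, L.length ≤ k + I.length → ∀ β,
      eLpNorm (fun y : Space => jetZ L J [β] (t, y)) 2 ν ≤ M) :
    AEStronglyMeasurable (fun y : Space => sumDZ k (jetZ I J) (t, y)) ν ∧
      eLpNorm (fun y : Space => sumDZ k (jetZ I J) (t, y)) 2 ν ≤ (4 * 12 ^ k : ℕ) * M := by
  induction k generalizing I with
  | zero =>
    have hm' : ∀ β, AEStronglyMeasurable (fun y : Space => |jetZ I J [β] (t, y)|) ν := fun β =>
      (hm I (by simp) β).norm
    have e : (fun y : Space => sumDZ 0 (jetZ I J) (t, y))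
        = ∑ β, fun y : Space => |jetZ I J [β] (t, y)| := by
      ext y; simp [sumDZ]
    rw [e]
    refine ⟨Finset.aestronglyMeasurable_sum _ fun β _ => hm' β,
      (eLpNorm_sum_le (fun β _ => hm' β) (by norm_num)).trans ?_⟩
    refine (Finset.sum_le_card_nsmul _ _ M fun β _ => ?_).trans (by simp)
    exact (eLpNorm_norm (fun y : Space => jetZ I J [β] (t, y))).le.trans (hM I (by simp) β)
  | succ k ih =>
    have h1 := ih I (fun L hL => hm L (by omega)) (fun L hL => hM L (by omega))
    have h2 : ∀ Z, _ := fun Z => ih (Z :: I)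
      (fun L hL => hm L (by simp only [List.length_cons] at hL; omega))
      (fun L hL => hM L (by simp only [List.length_cons] at hL; omega))
    have e : (fun y : Space => sumDZ (k + 1) (jetZ I J) (t, y))
        = (fun y : Space => sumDZ k (jetZ I J) (t, y))
          + ∑ Z, fun y : Space => sumDZ k (jetZ (Z :: I) J) (t, y) := by
      ext y
      simp only [sumDZ, Pi.add_apply, Finset.sum_apply]
      rfl
    have hs : AEStronglyMeasurable (∑ Z, fun y : Space => sumDZ k (jetZ (Z :: I) J) (t, y)) ν :=
      Finset.aestronglyMeasurable_sum _ fun Z _ => (h2 Z).1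
    rw [e]
    refine ⟨h1.1.add hs, (eLpNorm_add_le h1.1 hs (by norm_num)).trans ?_⟩
    have h3 : eLpNorm (∑ Z, fun y : Space => sumDZ k (jetZ (Z :: I) J) (t, y)) 2 ν
        ≤ 11 * ((4 * 12 ^ k : ℕ) * M) := by
      refine (eLpNorm_sum_le (fun Z _ => (h2 Z).1) (by norm_num)).trans ?_
      refine (Finset.sum_le_card_nsmul _ _ _ fun Z _ => (h2 Z).2).trans (le_of_eq ?_)
      have h7 : Fintype.card ZField = 11 := by decide
      rw [Finset.card_univ, h7, nsmul_eq_mul]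
      norm_num
    refine (add_le_add h1.2 h3).trans (le_of_eq ?_)
    push_cast
    ring

/-- On a slab of finite height the weight is bounded below by a power of `1 + |x|`: for `q < 0` the
point `x` stays in a bounded set. -/
lemma rpow_le_weight {T γ μ t : ℝ} (hγ : 0 < γ) (ht0 : 0 ≤ t) (htT : t ≤ T) (y : Space) :
    ((1 + ‖y‖) / (1 + T)) ^ (1 + 2 * γ) ≤ weight γ μ (qvar (t, y)) := by
  have hT : 0 < 1 + T := by linarith
  have hy := norm_nonneg y
  unfold weight
  have hq : qvar (t, y) = ‖y‖ - t := rfl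
  split_ifs with h
  · rw [abs_of_pos h]
    have h1 : (1 + ‖y‖) / (1 + T) ≤ 1 + qvar (t, y) := by
      rw [div_le_iff₀ hT, hq]
      rw [hq] at h
      nlinarith
    have h2 := Real.rpow_le_rpow (z := 1 + 2 * γ) (by positivity) h1 (by linarith)
    linarith
  · rw [hq, not_lt] at h
    have h1 : ((1 + ‖y‖) / (1 + T)) ^ (1 + 2 * γ) ≤ 1 := by
      refine Real.rpow_le_one (by positivity) ?_ (by linarith)
      rw [div_le_one hT]
      linarith
    have h2 : 0 ≤ (1 + |qvar (t, y)|) ^ (-2 * μ) := by positivity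
    linarith

lemma IsSobolevJet.tendsto_eLpNorm_jetZ_mollJet_sub {N : ℕ} {T : ℝ} {u : Spacetime → ℝ} {J : Jet}
    (hJ : IsSobolevJet (N + 1) T u J) {t : ℝ} (ht : t ∈ Set.Ioo (-T) T) (x : Space) (ρ : ℝ)
    {L : List ZField} (hL : L.length ≤ N) (β : Fin 4) :
    (∀ i : Option ℕ, AEStronglyMeasurable
        (fun y : Space => jetZ L (i.elim J fun n => mollJet n J) [β] (t, y))
        (volume.restrict (Metric.ball x ρ))) ∧
      Tendsto (fun n => eLpNorm (fun y : Space =>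
        jetZ L (mollJet n J) [β] (t, y) - jetZ L J [β] (t, y)) 2
        (volume.restrict (Metric.ball x ρ))) atTop (𝓝 0) := by
  have hle : ∀ a : List (Fin 4), a.length ≤ 1 + L.length → a.length ≤ N + 1 := fun a ha => by omega
  have h1 : ∀ a : List (Fin 4), a ≠ [] → a.length ≤ 1 + L.length → ∀ n,
      AEStronglyMeasurable (fun y : Space => mollJet n J a (t, y)) volume := fun a _ ha n =>
    ((hJ.isClassicalJet_mollJet n).continuous_slice (hle a ha) ht).aestronglyMeasurable
  have h2 : ∀ a : List (Fin 4), a ≠ [] → a.length ≤ 1 + L.length →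
      AEStronglyMeasurable (fun y : Space => J a (t, y)) volume := fun a _ ha =>
    hJ.aestronglyMeasurable (hle a ha) ht
  have h3 : ∀ a : List (Fin 4), a ≠ [] → a.length ≤ 1 + L.length →
      Tendsto (fun n => eLpNorm (fun y : Space => mollJet n J a (t, y) - J a (t, y)) 2 volume)
        atTop (𝓝 0) := by
    intro a ha0 ha
    have hp : Tendsto (fun n : ℕ => (n, t)) atTop (atTop ×ˢ 𝓝 t) :=
      tendsto_id.prodMk tendsto_const_nhds
    have h := (hJ.tendsto_eLpNorm_mollJet_sub ha0 (hle a ha) ht).comp hp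
    simpa only [Function.comp_def] using h
  have h4 : [β].length ≤ 1 := le_refl 1
  exact tendsto_eLpNorm_jetZ_sub (k := 1) (U := fun n => mollJet n J) (J := J) (t := t) (a := [β]) L
    h1 h2 h3 (List.cons_ne_nil _ _) h4

/-- The mollified fields inherit the `L²` bounds, with twice the constant. -/
lemma IsSobolevJet.eventually_eLpNorm_jetZ_mollJet_le {N : ℕ} {T : ℝ} {u : Spacetime → ℝ} {J : Jet}
    (hJ : IsSobolevJet (N + 1) T u J) {t : ℝ} (ht : t ∈ Set.Ioo (-T) T) {x : Space} {ρ : ℝ} {M : ℝ}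
    (hM : 0 < M) (h : ∀ L : List ZField, L.length ≤ N → ∀ β,
      eLpNorm (fun y : Space => jetZ L J [β] (t, y)) 2 (volume.restrict (Metric.ball x ρ))
        ≤ ENNReal.ofReal M) :
    ∀ᶠ n in atTop, ∀ L ∈ {L : List ZField | L.length ≤ N}, ∀ β,
      eLpNorm (fun y : Space => jetZ L (mollJet n J) [β] (t, y)) 2
        (volume.restrict (Metric.ball x ρ)) ≤ ENNReal.ofReal (2 * M) := by
  refine (eventually_all_finite (List.finite_length_le ZField N)).2 fun L hL =>
    eventually_all.2 fun β => ?_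
  obtain ⟨hm, hlim⟩ := hJ.tendsto_eLpNorm_jetZ_mollJet_sub ht x ρ hL β
  filter_upwards [hlim.eventually (gt_mem_nhds (ENNReal.ofReal_pos.2 hM))] with n hn
  have e1 : (fun y : Space => jetZ L (mollJet n J) [β] (t, y))
      = (fun y : Space => jetZ L (mollJet n J) [β] (t, y) - jetZ L J [β] (t, y))
        + fun y : Space => jetZ L J [β] (t, y) := by
    ext y; simp
  have hmn : AEStronglyMeasurable (fun y : Space => jetZ L (mollJet n J) [β] (t, y))
    (volume.restrict (Metric.ball x ρ)) := hm (some n)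
  have hm0 : AEStronglyMeasurable (fun y : Space => jetZ L J [β] (t, y))
    (volume.restrict (Metric.ball x ρ)) := hm none
  rw [e1, two_mul, ENNReal.ofReal_add hM.le hM.le]
  exact (eLpNorm_add_le (hmn.sub hm0) hm0 (by norm_num)).trans (add_le_add hn.le (h L hL β))

lemma quarter_le_one_add_norm {x y : Space} (hy : y ∈ Metric.ball x ((1 + ‖x‖) / 4)) :
    (1 + ‖x‖) / 4 ≤ 1 + ‖y‖ := by
  have h1 : ‖x - y‖ < (1 + ‖x‖) / 4 := by rw [← dist_eq_norm, dist_comm]; exact hy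
  have h2 : ‖x‖ ≤ ‖y‖ + ‖x - y‖ := norm_le_norm_add_norm_sub' x y
  linarith [norm_nonneg x]

/-- The Klainerman–Sobolev inequality on a slab of finite height: on the ball of radius
`ρ = (1 + |x|) / 4` around `x` the fields of the family are worth `ρ ∂_α`. -/
theorem exists_klainerman_sobolev_const {T : ℝ} (hT : 0 < T) : ∃ K : ℝ, 0 < K ∧ ∀ g : Jet,
    IsClassicalJet 3 T g → ∀ t ∈ Set.Ioo (-T) T, ∀ (α : Fin 4) (x : Space),
      ENNReal.ofReal |g [α] (t, x)| ≤ ENNReal.ofReal (K * ((1 + ‖x‖) / 4) ^ (-(3 / 2) : ℝ))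
        * eLpNorm (fun y : Space => sumDZ 2 g (t, y)) 2
          (volume.restrict (Metric.ball x ((1 + ‖x‖) / 4))) := by
  obtain ⟨S, hS, hsob⟩ := exists_sobolev_const
  set c₁ : ℝ := (8 + 6 * T) * 22 with hc₁
  set c₂ : ℝ := (8 + 6 * T) * ((8 + 6 * T) * 22) * 177 with hc₂
  have hc₁0 : 0 < c₁ := by positivity
  have hc₂0 : 0 < c₂ := by positivity
  set c : ℝ := 1 + 3 * c₁ + 9 * c₂ with hc
  have hc0 : 0 < c := by positivity
  refine ⟨S * c, by positivity, fun g hg t ht α x => ?_⟩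
  have htabs : |t| ≤ T := abs_le.2 ⟨ht.1.le, ht.2.le⟩
  have hx := norm_nonneg x
  have hρ : 0 < (1 + ‖x‖) / 4 := by positivity
  have hball : ∀ y ∈ Metric.ball x ((1 + ‖x‖) / 4), (1 + ‖x‖) / 4 ≤ 1 + ‖y‖ :=
    fun y hy => quarter_le_one_add_norm hy
  set ρ : ℝ := (1 + ‖x‖) / 4
  have hG : ∀ y ∈ Metric.ball x ρ, |g [α] (t, y)| + ρ * ∑ i : Fin 3, |g [i.succ, α] (t, y)|
      + ρ ^ 2 * ∑ i : Fin 3, ∑ j : Fin 3, |g [j.succ, i.succ, α] (t, y)|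
      ≤ c * sumDZ 2 g (t, y) := by
    intro y hy
    have hsym : SymmAt 3 (t, y) g := hg.symmAt ht
    have h0 := abs_le_sumDZ 2 g (t, y) α
    have hs1 : sumDZ 1 g (t, y) ≤ sumDZ 2 g (t, y) :=
      le_add_of_nonneg_right (Finset.sum_nonneg fun Z _ => sumDZ_nonneg _ _ _)
    have hyρ := hball y hy
    have h1 : ∀ i : Fin 3, ρ * |g [i.succ, α] (t, y)| ≤ c₁ * sumDZ 2 g (t, y) := fun i =>
      (mul_le_mul_of_nonneg_right hyρ (abs_nonneg _)).trans
        ((one_add_norm_mul_abs_second_le htabs (hsym.mono (by norm_num)) α i.succ).trans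
          (mul_le_mul_of_nonneg_left hs1 hc₁0.le))
    have h2 : ∀ i j : Fin 3, ρ ^ 2 * |g [j.succ, i.succ, α] (t, y)| ≤ c₂ * sumDZ 2 g (t, y) :=
      fun i j => (mul_le_mul_of_nonneg_right (pow_le_pow_left₀ hρ.le hyρ 2)
        (abs_nonneg _)).trans (sq_one_add_norm_mul_abs_third_le htabs hsym α i.succ j.succ)
    simp only [Fin.sum_univ_three, mul_add]
    rw [hc]
    linarith [h1 0, h1 1, h1 2, h2 0 0, h2 0 1, h2 0 2, h2 1 0, h2 1 1, h2 1 2, h2 2 0, h2 2 1,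
      h2 2 2]
  have h1 := hsob (fun y => g [α] (t, y)) (fun i y => g [i.succ, α] (t, y))
    (fun j i y => g [j.succ, i.succ, α] (t, y)) (fun y => hg.hasFDerivAt_slice (by simp) ht y)
    (fun i y => hg.hasFDerivAt_slice (by simp) ht y)
    (fun j i => hg.continuous_slice (by simp) ht) ρ hρ x (fun y => c * sumDZ 2 g (t, y)) hG
  refine h1.trans ?_
  have e : S * c * ρ ^ (-(3 / 2) : ℝ) = S * ρ ^ (-(3 / 2) : ℝ) * c := by ring
  rw [e, ENNReal.ofReal_mul (q := c) (by positivity), mul_assoc]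
  refine mul_le_mul_right ?_ _
  refine eLpNorm_le_mul_eLpNorm_of_ae_le_mul (Eventually.of_forall fun y => ?_) 2
  rw [norm_mul, Real.norm_of_nonneg hc0.le]

/-- The derivatives of `Z^I u` decay at the rate `(1 + |x|)^{-2-γ}`, where `(1 + |x|)^{-3/2}` comes
from the scaled Sobolev inequality and `(1 + |x|)^{-1/2-γ}` from the weight. -/
theorem exists_abs_jetZ_le {T γ : ℝ} (hT : 0 < T) (hγ : 0 < γ) (μ : ℝ) : ∃ K : ℝ, 0 < K ∧
    ∀ (N : ℕ) (u : Spacetime → ℝ) (J V : Jet), IsSobolevJet (N + 1) T u J →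
      (∀ a : List (Fin 4), a.length + 1 ≤ N → ∀ p ∈ slab T,
        Tendsto (fun n => mollJet n J a p) atTop (𝓝 (V a p))) →
      ∀ t ∈ Set.Ico 0 T, ∀ e : ℝ, 0 < e →
      (∀ L : List ZField, L.length ≤ N → ∀ β, eLpNorm (fun x : Space =>
        √(weight γ μ (qvar (t, x))) * jetZ L J [β] (t, x)) 2 volume ≤ ENNReal.ofReal e) →
      ∀ I : List ZField, I.length + 2 ≤ N → ∀ (α : Fin 4) (x : Space),
        |jetZ I V [α] (t, x)| ≤ K * e * (1 + ‖x‖) ^ (-2 - γ) := by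
  obtain ⟨S, hS, hsob⟩ := exists_klainerman_sobolev_const hT
  refine ⟨S * 576 * 2 * (1 + T) ^ (1 / 2 + γ) * (1 / 4 : ℝ) ^ (-2 - γ), by positivity, ?_⟩
  intro N u J V hJ hV t ht e he hE I hI α x
  have htm : t ∈ Set.Ioo (-T) T := ⟨by linarith [ht.1], ht.2⟩
  have hx := norm_nonneg x
  have hball : ∀ y ∈ Metric.ball x ((1 + ‖x‖) / 4), (1 + ‖x‖) / 4 ≤ 1 + ‖y‖ :=
    fun y hy => quarter_le_one_add_norm hy
  have hsobx := fun g hg => hsob g hg t htm α x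
  set ρ : ℝ := (1 + ‖x‖) / 4 with hρdef
  have hρ : 0 < ρ := by positivity
  set κ : ℝ := (ρ / (1 + T)) ^ (1 / 2 + γ) with hκdef
  have hκ : 0 < κ := by positivity
  have hweight : ∀ y ∈ Metric.ball x ρ, κ ≤ √(weight γ μ (qvar (t, y))) := by
    intro y hy
    refine Real.le_sqrt_of_sq_le (le_trans ?_ (rpow_le_weight hγ ht.1 ht.2.le y))
    rw [hκdef, ← Real.rpow_natCast, ← Real.rpow_mul (by positivity)]
    have : (1 / 2 + γ) * ((2 : ℕ) : ℝ) = 1 + 2 * γ := by push_cast; ring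
    rw [this]
    refine Real.rpow_le_rpow (by positivity) ?_ (by linarith)
    exact div_le_div_of_nonneg_right (hball y hy) (by positivity)
  -- the unweighted bound on the ball
  have hJL : ∀ L : List ZField, L.length ≤ N → ∀ β,
      eLpNorm (fun y : Space => jetZ L J [β] (t, y)) 2 (volume.restrict (Metric.ball x ρ))
        ≤ ENNReal.ofReal (κ⁻¹ * e) := by
    intro L hL β
    rw [ENNReal.ofReal_mul (by positivity)]
    refine le_trans ?_ (mul_le_mul_right (hE L hL β) _)
    refine le_trans ?_ (mul_le_mul_right (eLpNorm_mono_measure _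
      (Measure.restrict_le_self (s := Metric.ball x ρ))) _)
    refine eLpNorm_le_mul_eLpNorm_of_ae_le_mul ?_ 2
    filter_upwards [ae_restrict_mem measurableSet_ball] with y hy
    rw [norm_mul, Real.norm_of_nonneg (Real.sqrt_nonneg _), ← mul_assoc]
    refine le_mul_of_one_le_left (norm_nonneg _) ?_
    rw [← div_eq_inv_mul, one_le_div hκ]
    exact hweight y hy
  have hκe : 0 < κ⁻¹ * e := by positivity
  have hbound : ∀ᶠ n in atTop, |jetZ I (mollJet n J) [α] (t, x)|
      ≤ S * ρ ^ (-(3 / 2) : ℝ) * (576 * (2 * (κ⁻¹ * e))) := by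
    filter_upwards [hJ.eventually_eLpNorm_jetZ_mollJet_le htm hκe hJL] with n hn
    have hg : IsClassicalJet 3 T (jetZ I (mollJet n J)) :=
      IsClassicalJet.jetZ I ((hJ.isClassicalJet_mollJet n).mono (by omega))
    have h2 : eLpNorm (fun y => sumDZ 2 (jetZ I (mollJet n J)) (t, y)) 2
        (volume.restrict (Metric.ball x ρ)) ≤ ENNReal.ofReal (576 * (2 * (κ⁻¹ * e))) := by
      refine (eLpNorm_sumDZ_le 2 I (fun L hL β =>
        (hJ.tendsto_eLpNorm_jetZ_mollJet_sub htm x ρ (by omega) β).1 (some n))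
        (fun L hL β => hn L (show L.length ≤ N by omega) β)).2.trans (le_of_eq ?_)
      rw [ENNReal.ofReal_mul (by norm_num)]
      norm_num
    have h4 := (hsobx _ hg).trans (mul_le_mul_right h2 _)
    rw [← ENNReal.ofReal_mul (by positivity)] at h4
    exact (ENNReal.ofReal_le_ofReal_iff (by positivity)).1 h4
  have hlim : Tendsto (fun n => jetZ I (mollJet n J) [α] (t, x)) atTop (𝓝 (jetZ I V [α] (t, x))) :=
    tendsto_jetZ (k := 1) I (fun a ha => hV a (by omega) _ htm) (by simp) (by simp)
  refine (le_of_tendsto hlim.abs hbound).trans (le_of_eq ?_)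
  have hx1 : 0 < 1 + ‖x‖ := by positivity
  have e1 : κ⁻¹ = (1 + T) ^ (1 / 2 + γ) * ρ ^ (-(1 / 2 + γ)) := by
    rw [hκdef, Real.div_rpow hρ.le (by positivity), inv_div, Real.rpow_neg hρ.le, div_eq_mul_inv]
  have e2 : ρ ^ (-(3 / 2) : ℝ) * ρ ^ (-(1 / 2 + γ)) = (1 + ‖x‖) ^ (-2 - γ) * (1 / 4) ^ (-2 - γ) := by
    rw [← Real.rpow_add hρ, ← Real.mul_rpow hx1.le (by norm_num), hρdef, div_eq_mul_one_div]
    congr 1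
    ring
  rw [e1]
  calc _ = S * 576 * 2 * (1 + T) ^ (1 / 2 + γ) * e
        * (ρ ^ (-(3 / 2) : ℝ) * ρ ^ (-(1 / 2 + γ))) := by ring
    _ = _ := by rw [e2]; ring

/-- The fields of the family grow at most linearly on a slab of finite height. -/
lemma abs_applyZ_le {T : ℝ} {p : Spacetime} (hT : |p.1| ≤ T) (Z : ZField) (J : Jet) :
    |applyZ jetD jetX Z J [] p| ≤ (1 + T) * (1 + ‖p.2‖) * ∑ β, |J [β] p| := by
  have hT0 : 0 ≤ T := (abs_nonneg _).trans hT
  have hx := norm_nonneg p.2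
  have hc : ∀ β, |coord β p| ≤ (1 + T) * (1 + ‖p.2‖) := fun β => by
    nlinarith [abs_coord_le β p]
  have h1 : 1 ≤ (1 + T) * (1 + ‖p.2‖) := by nlinarith
  set c := (1 + T) * (1 + ‖p.2‖)
  have hc0 : 0 ≤ c := zero_le_one.trans h1
  have hterm : ∀ β γ, |coord β p * J [γ] p| ≤ c * |J [γ] p| := fun β γ => by
    rw [abs_mul]
    exact mul_le_mul_of_nonneg_right (hc β) (abs_nonneg _)
  have hmink : ∀ α, |mink α| = 1 := fun α => by
    unfold mink
    split_ifs <;> simp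
  rcases Z with α | ⟨⟨α, β⟩, hαβ⟩ | _
  · have h2 : |J [α] p| ≤ ∑ β, |J [β] p| :=
      Finset.single_le_sum (f := fun β => |J [β] p|) (fun _ _ => abs_nonneg _) (Finset.mem_univ α)
    exact h2.trans (le_mul_of_one_le_left ((abs_nonneg _).trans h2) h1)
  · have hne : α ≠ β := hαβ.ne
    have h2 : |J [β] p| + |J [α] p| ≤ ∑ β, |J [β] p| := by
      rw [add_comm, ← Finset.sum_pair (f := fun β => |J [β] p|) hne]
      exact Finset.sum_le_univ_sum_of_nonneg fun _ => abs_nonneg _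
    simp only [applyZ, Pi.add_apply, Pi.neg_apply, Pi.smul_apply, smul_eq_mul, jetX_nil, jetD,
      List.nil_append]
    refine (abs_add_le _ _).trans ?_
    rw [abs_neg, abs_mul, abs_mul (mink β), hmink, hmink, one_mul, one_mul]
    nlinarith [hterm α β, hterm β α, mul_le_mul_of_nonneg_left h2 hc0]
  · simp only [applyZ, Finset.sum_apply, jetX_nil, jetD, List.nil_append]
    rw [Finset.mul_sum]
    exact (Finset.abs_sum_le_sum_abs _ _).trans (Finset.sum_le_sum fun β _ => hterm β β)

/-- Integration from infinity of a derivative that decays like a power. -/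
lemma abs_le_of_abs_deriv_le_rpow {φ φ' : ℝ → ℝ} {c a γ : ℝ} (hc : 0 ≤ c) (ha : 0 < a) (hγ : 0 < γ)
    (hd : ∀ s, 0 ≤ s → HasDerivAt φ (φ' s) s)
    (hb : ∀ s, 0 ≤ s → |φ' s| ≤ c * (a + s) ^ (-2 - γ)) (hlim : Tendsto φ atTop (𝓝 0)) :
    |φ 0| ≤ c * a ^ (-1 - γ) := by
  set k : ℝ := c / (1 + γ)
  have hk : k * (1 + γ) = c := div_mul_cancel₀ _ (by positivity)
  have hkc : k ≤ c := div_le_self hc (by linarith)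
  have hpos : ∀ s, 0 ≤ s → 0 < a + s := fun s hs => by linarith
  have hh : ∀ s, 0 ≤ s →
      HasDerivAt (fun s => k * (a + s) ^ (-1 - γ)) (-(c * (a + s) ^ (-2 - γ))) s := by
    intro s hs
    have h1 := (((hasDerivAt_id s).const_add a).rpow_const (p := -1 - γ)
      (Or.inl (hpos s hs).ne')).const_mul k
    refine h1.congr_deriv ?_
    have e : -1 - γ - 1 = -2 - γ := by ring
    simp only [id, e, ← hk]
    ring
  have hlimh : Tendsto (fun s => k * (a + s) ^ (-1 - γ)) atTop (𝓝 0) := by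
    have h1 := (tendsto_rpow_neg_atTop (y := 1 + γ) (by linarith)).comp
      (tendsto_atTop_add_const_left atTop a tendsto_id)
    have e : -1 - γ = -(1 + γ) := by ring
    simpa [Function.comp_def, e] using h1.const_mul k
  have key : ∀ ψ ψ' : ℝ → ℝ, (∀ s, 0 ≤ s → HasDerivAt ψ (ψ' s) s) →
      (∀ s, 0 ≤ s → ψ' s ≤ c * (a + s) ^ (-2 - γ)) → Tendsto ψ atTop (𝓝 0) →
      -ψ 0 ≤ c * a ^ (-1 - γ) := by
    intro ψ ψ' hψ hψ' hψlim
    have hF : ∀ s, 0 ≤ s → HasDerivAt (fun s => ψ s + k * (a + s) ^ (-1 - γ))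
        (ψ' s + -(c * (a + s) ^ (-2 - γ))) s := fun s hs => (hψ s hs).add (hh s hs)
    -- `ψ + k (a + s) ^ (-1 - γ)` decreases to its limit `0`
    have hanti : AntitoneOn (fun s => ψ s + k * (a + s) ^ (-1 - γ)) (Set.Ici 0) := by
      refine antitoneOn_of_deriv_nonpos (convex_Ici 0)
        (fun s hs => (hF s hs).continuousAt.continuousWithinAt)
        (fun s hs => (hF s (interior_subset hs)).differentiableAt.differentiableWithinAt)
        fun s hs => ?_
      rw [(hF s (interior_subset hs)).deriv]
      linarith [hψ' s (interior_subset hs)]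
    have h0 : (0 : ℝ) ≤ ψ 0 + k * (a + 0) ^ (-1 - γ) := by
      refine le_of_tendsto (by simpa using hψlim.add hlimh) ?_
      filter_upwards [eventually_ge_atTop 0] with s hs
      exact hanti (Set.mem_Ici.2 le_rfl) hs hs
    rw [add_zero] at h0
    have : k * a ^ (-1 - γ) ≤ c * a ^ (-1 - γ) :=
      mul_le_mul_of_nonneg_right hkc (by positivity)
    linarith
  rw [abs_le]
  constructor
  · linarith [key φ φ' hd (fun s hs => (le_abs_self _).trans (hb s hs)) hlim]
  · have := key (fun s => -φ s) (fun s => -φ' s) (fun s hs => (hd s hs).neg)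
      (fun s hs => (neg_le_abs _).trans (hb s hs)) (by simpa using hlim.neg)
    linarith

/-- A function that vanishes at spatial infinity at time `0` and has a decaying time derivative
vanishes at spatial infinity at time `t`. -/
lemma IsClassicalJet.tendsto_cocompact {T B γ : ℝ} {V : Jet} (hV : IsClassicalJet 1 T V) (hγ : 0 < γ)
    (h0 : Tendsto (fun x : Space => V [] (0, x)) (cocompact Space) (𝓝 0))
    {t : ℝ} (ht : t ∈ Set.Ico 0 T)
    (hB : ∀ τ ∈ Set.Icc 0 t, ∀ x : Space, |V [0] (τ, x)| ≤ B * (1 + ‖x‖) ^ (-2 - γ)) :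
    Tendsto (fun x : Space => V [] (t, x)) (cocompact Space) (𝓝 0) := by
  have hdiff : ∀ x : Space, ‖V [] (t, x) - V [] (0, x)‖ ≤ B * (1 + ‖x‖) ^ (-2 - γ) * ‖t - 0‖ := by
    intro x
    refine (convex_Icc 0 t).norm_image_sub_le_of_norm_hasDerivWithin_le
      (f := fun τ => V [] (τ, x)) (f' := fun τ => V [0] (τ, x)) (fun τ hτ => ?_)
      (fun τ hτ => hB τ hτ x) (Set.left_mem_Icc.2 ht.1) (Set.right_mem_Icc.2 ht.1)
    have hτm : (τ, x) ∈ slab T := ⟨by linarith [hτ.1, ht.1, ht.2], hτ.2.trans_lt ht.2⟩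
    have h1 := (hV.hasFDerivAt [] (by simp) _ hτm).comp_hasDerivAt τ
      ((hasDerivAt_id τ).prodMk (hasDerivAt_const τ x))
    refine (h1.congr_deriv ?_).hasDerivWithinAt
    rw [stCovec_eq_coprod]
    simp
  have hdecay : Tendsto (fun x : Space => B * (1 + ‖x‖) ^ (-2 - γ) * ‖t - 0‖) (cocompact Space)
      (𝓝 0) := by
    have h1 := (tendsto_rpow_neg_atTop (y := 2 + γ) (by linarith)).comp
      (tendsto_atTop_add_const_left (cocompact Space) 1 tendsto_norm_cocompact_atTop)
    have e : -2 - γ = -(2 + γ) := by ring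
    simpa [Function.comp_def, e] using (h1.const_mul B).mul_const ‖t - 0‖
  simpa using (squeeze_zero_norm hdiff hdecay).add h0

/-- The bound for the field itself: the value is recovered from its spatial derivatives by
integration along the outgoing ray. -/
lemma IsClassicalJet.abs_nil_le {T B γ : ℝ} {V : Jet} (hV : IsClassicalJet 1 T V) (hγ : 0 < γ)
    (hB0 : 0 ≤ B) {t : ℝ} (ht : t ∈ Set.Ioo (-T) T)
    (h0 : Tendsto (fun x : Space => V [] (t, x)) (cocompact Space) (𝓝 0))
    (hB : ∀ (α : Fin 4) (x : Space), |V [α] (t, x)| ≤ B * (1 + ‖x‖) ^ (-2 - γ)) (x : Space) :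
    |V [] (t, x)| ≤ 3 * B * (1 + ‖x‖) ^ (-1 - γ) := by
  obtain ⟨θ, hθ, hxθ⟩ : ∃ θ : Space, ‖θ‖ = 1 ∧ x = ‖x‖ • θ := by
    rcases eq_or_ne x 0 with rfl | hx
    · exact ⟨EuclideanSpace.single 0 1, by simp, by simp⟩
    · exact ⟨‖x‖⁻¹ • x, norm_smul_inv_norm (𝕜 := ℝ) hx, by
        rw [smul_inv_smul₀ (norm_ne_zero_iff.2 hx)]⟩
  have hnorm : ∀ s : ℝ, 0 ≤ s → ‖x + s • θ‖ = ‖x‖ + s := by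
    intro s hs
    have e : x + s • θ = (‖x‖ + s) • θ := by rw [add_smul, ← hxθ]
    rw [e, norm_smul, hθ, mul_one, Real.norm_of_nonneg (by positivity)]
  have hray : Tendsto (fun s : ℝ => x + s • θ) atTop (cocompact Space) := by
    rw [← Metric.cobounded_eq_cocompact, ← tendsto_norm_atTop_iff_cobounded]
    refine (tendsto_atTop_add_const_left atTop ‖x‖ tendsto_id).congr' ?_
    filter_upwards [eventually_ge_atTop 0] with s hs
    exact (hnorm s hs).symm
  have hθi : ∀ i, |θ i| ≤ 1 := fun i => (PiLp.norm_apply_le θ i).trans hθ.le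
  have h1 := abs_le_of_abs_deriv_le_rpow (φ := fun s => V [] (t, x + s • θ))
    (φ' := fun s => covec (fun i => V [i.succ] (t, x + s • θ)) θ) (c := 3 * B) (a := 1 + ‖x‖)
    (by positivity) (by positivity) hγ (fun s _ => ?_) (fun s hs => ?_) (h0.comp hray)
  · simpa using h1
  · have h2 : HasDerivAt (fun s : ℝ => x + s • θ) θ s := by
      simpa using ((hasDerivAt_id s).smul_const θ).const_add x
    exact (hV.hasFDerivAt_slice (a := []) (by simp) ht _).comp_hasDerivAt s h2
  · rw [covec_apply]
    refine (Finset.abs_sum_le_sum_abs _ _).trans ?_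
    refine (Finset.sum_le_card_nsmul _ _ (B * (1 + ‖x + s • θ‖) ^ (-2 - γ)) fun i _ => ?_).trans
      (le_of_eq ?_)
    · rw [abs_mul]
      exact (mul_le_of_le_one_right (abs_nonneg _) (hθi i)).trans (hB i.succ _)
    · rw [hnorm s hs, ← add_assoc]
      simp
      ring

/-- The decay of one component `u` and its images under `Z^I`. -/
theorem exists_component_decay {T γ : ℝ} (hT : 0 < T) (hγ : 0 < γ) (μ : ℝ) : ∃ K : ℝ, 0 < K ∧
    ∀ (m : ℕ) (u : Spacetime → ℝ) (J : Jet), IsSobolevJet (m + 2) T u J →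
      Tendsto (fun x : Space => u (0, x)) (cocompact Space) (𝓝 0) →
      ∀ t ∈ Set.Ico 0 T, ∀ e : ℝ, 0 < e →
      (∀ τ ∈ Set.Icc 0 t, ∀ L : List ZField, L.length ≤ m + 1 → ∀ β, eLpNorm (fun x : Space =>
        √(weight γ μ (qvar (τ, x))) * jetZ L J [β] (τ, x)) 2 volume ≤ ENNReal.ofReal e) →
      ∀ I : List ZField, I.length + 1 ≤ m → ∀ x : Space,
        (∀ α, |pd α (Zc I u) (t, x)| ≤ K * e * (1 + ‖x‖) ^ (-2 - γ)) ∧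
          |Zc I u (t, x)| ≤ K * e * (1 + ‖x‖) ^ (-1 - γ) := by
  obtain ⟨K, hK, hdecay⟩ := exists_abs_jetZ_le hT hγ μ
  refine ⟨4 * (1 + T) * K, by positivity, ?_⟩
  intro m u J hJ h0 t ht e he hE I hI x
  obtain ⟨V, rfl, hV, hlim⟩ := hJ.exists_isClassicalJet
  have hd : ∀ τ ∈ Set.Icc 0 t, ∀ I : List ZField, I.length + 1 ≤ m → ∀ α (x : Space),
      |jetZ I V [α] (τ, x)| ≤ K * e * (1 + ‖x‖) ^ (-2 - γ) := fun τ hτ I hI =>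
    hdecay (m + 1) _ J V hJ (fun a ha => hlim a (by omega)) τ ⟨hτ.1, hτ.2.trans_lt ht.2⟩ e he
      (hE τ hτ) I (by omega)
  have htt : t ∈ Set.Icc 0 t := ⟨ht.1, le_rfl⟩
  have htm : t ∈ Set.Ioo (-T) T := ⟨by linarith [ht.1], ht.2⟩
  have hp : (t, x) ∈ slab T := htm
  have hx : 0 < 1 + ‖x‖ := by positivity
  constructor
  · intro α
    rw [hV.pd_Zc_eq (by omega) hp]
    refine (hd t htt I hI α x).trans (mul_le_mul_of_nonneg_right ?_ (by positivity))
    nlinarith [mul_pos hK he, mul_pos hT (mul_pos hK he)]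
  · rw [hV.Zc_eq (by omega) hp]
    rcases I with _ | ⟨Z, I⟩
    · have hV1 : IsClassicalJet 1 T V := hV.mono (by omega)
      have h1 := hV1.abs_nil_le hγ (by positivity) htm
        (hV1.tendsto_cocompact hγ h0 ht fun τ hτ x => hd τ hτ [] hI 0 x) (hd t htt [] hI) x
      refine h1.trans (mul_le_mul_of_nonneg_right ?_ (by positivity))
      nlinarith [mul_pos hK he, mul_pos hT (mul_pos hK he)]
    · have hI' : I.length + 1 ≤ m := by simp only [List.length_cons] at hI; omega
      refine (abs_applyZ_le (T := T) (abs_le.2 ⟨htm.1.le, htm.2.le⟩) Z (jetZ I V)).trans ?_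
      have h2 : ∑ β, |jetZ I V [β] (t, x)| ≤ 4 * (K * e * (1 + ‖x‖) ^ (-2 - γ)) := by
        refine (Finset.sum_le_card_nsmul _ _ _ fun β _ => hd t htt I hI' β x).trans (le_of_eq ?_)
        simp
      have e1 : (1 + ‖x‖) ^ (-1 - γ) = (1 + ‖x‖) * (1 + ‖x‖) ^ (-2 - γ) := by
        rw [← Real.rpow_one_add' hx.le (by linarith)]
        congr 1
        ring
      rw [e1]
      refine (mul_le_mul_of_nonneg_left h2 (by positivity)).trans (le_of_eq ?_)
      ring

/-! ### The norms of tensor fields and the energy -/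

lemma sqrt_sum_sq_le {ι : Type*} [Fintype ι] {a : ι → ℝ} {B : ℝ} (hB : 0 ≤ B)
    (h : ∀ i, |a i| ≤ B) : √(∑ i, a i ^ 2) ≤ Fintype.card ι * B := by
  rw [Real.sqrt_le_left (by positivity)]
  have h1 : ∑ i, a i ^ 2 ≤ Fintype.card ι * B ^ 2 := by
    refine (Finset.sum_le_card_nsmul _ _ (B ^ 2) fun i _ => sq_le_sq' (abs_le.1 (h i)).1
      (abs_le.1 (h i)).2).trans (le_of_eq (by simp))
  refine h1.trans ?_
  rw [mul_pow]
  refine mul_le_mul_of_nonneg_right ?_ (by positivity)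
  exact_mod_cast Nat.le_self_pow two_ne_zero (Fintype.card ι)

lemma sqrt_sum_sum_sq_le {ι κ : Type*} [Fintype ι] [Fintype κ] {a : ι → κ → ℝ} {B : ℝ} (hB : 0 ≤ B)
    (h : ∀ i j, |a i j| ≤ B) :
    √(∑ i, ∑ j, a i j ^ 2) ≤ Fintype.card ι * Fintype.card κ * B := by
  have h1 := sqrt_sum_sq_le (a := fun q : ι × κ => a q.1 q.2) hB fun q => h q.1 q.2
  rwa [Fintype.sum_prod_type, Fintype.card_prod, Nat.cast_mul] at h1

lemma abs_omega_le (i : Fin 3) (p : Spacetime) : |omega i p| ≤ 1 := by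
  rw [omega, abs_div, abs_norm]
  exact div_le_one_of_le₀ (PiLp.norm_apply_le p.2 i) (norm_nonneg _)

lemma abs_tang_le {f : Spacetime → ℝ} {p : Spacetime} {B : ℝ} (hB : ∀ α, |pd α f p| ≤ B)
    (β : Fin 4) : |tang β f p| ≤ 4 * B := by
  have hmul : ∀ (i : Fin 3) (y : ℝ), |omega i p * y| ≤ |y| := fun i y => by
    rw [abs_mul]
    exact mul_le_of_le_one_left (abs_nonneg _) (abs_omega_le i p)
  have hr : |radial f p| ≤ 3 * B := by
    refine (Finset.abs_sum_le_sum_abs _ _).trans ((Finset.sum_le_card_nsmul _ _ B fun i _ =>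
      (hmul i _).trans (hB i.succ)).trans (le_of_eq (by simp)))
  refine Fin.cases ?_ (fun i => ?_) β
  · refine (abs_add_le (pd 0 f p) (radial f p)).trans ?_
    linarith [hB 0]
  · refine (abs_sub (pd i.succ f p) (omega i p * radial f p)).trans ?_
    linarith [hB i.succ, hmul i (radial f p)]

section Energy
variable {κ : Type} [Fintype κ]

lemma eLpNorm_le_energyTerm (γ μ : ℝ) (L : List ZField) (J : κ → Jet) (t : ℝ) (c : κ) (β : Fin 4) :
    eLpNorm (fun x : Space => √(weight γ μ (qvar (t, x))) * jetZ L (J c) [β] (t, x)) 2 volume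
      ≤ energyTerm γ μ L J t := by
  refine eLpNorm_mono_real fun x => ?_
  rw [norm_mul, Real.norm_of_nonneg (Real.sqrt_nonneg _)]
  refine mul_le_mul_of_nonneg_left (Real.abs_le_sqrt ?_) (Real.sqrt_nonneg _)
  refine le_trans ?_ (Finset.single_le_sum (f := fun c => ∑ α, (jetD α (jetZ L (J c)) [] (t, x)) ^ 2)
    (fun _ _ => Finset.sum_nonneg fun _ _ => sq_nonneg _) (Finset.mem_univ c))
  exact Finset.single_le_sum (f := fun α => (jetD α (jetZ L (J c)) [] (t, x)) ^ 2)
    (fun _ _ => sq_nonneg _) (Finset.mem_univ β)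

lemma energyTerm_add_le_energy {N : ℕ} (γ μ : ℝ) (Jh : Fin 4 × Fin 4 → Jet) (JA : Fin 4 → Jet)
    (t : ℝ) {L : List ZField} (hL : L.length ≤ N) :
    energyTerm γ μ L Jh t + energyTerm γ μ L JA t ≤ energy N γ μ Jh JA t := by
  have h1 : energyTerm γ μ L Jh t + energyTerm γ μ L JA t
      = energyTerm γ μ (List.ofFn L.get) Jh t + energyTerm γ μ (List.ofFn L.get) JA t := by
    rw [List.ofFn_get]
  rw [h1]
  refine (Finset.single_le_sum (f := fun I : Fin L.length → ZField =>
    energyTerm γ μ (List.ofFn I) Jh t + energyTerm γ μ (List.ofFn I) JA t)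
    (fun _ _ => zero_le) (Finset.mem_univ L.get)).trans ?_
  exact Finset.single_le_sum (f := fun k => ∑ I : Fin k → ZField,
    (energyTerm γ μ (List.ofFn I) Jh t + energyTerm γ μ (List.ofFn I) JA t))
    (fun _ _ => zero_le) (Finset.mem_range.2 (Nat.lt_succ_of_le hL))

end Energy

/-! ### Comparison of the weights -/

/-- Outside the light cone `1 + t + |q| = 1 + |x|` dominates `1 + |q|`. -/
lemma rpow_neg_add_le {t r q a b : ℝ} (ht : 0 ≤ t) (hq : 0 < q) (hr : q = r - t) (hb : 0 ≤ b) :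
    (1 + r) ^ (-(a + b)) ≤ (1 + t + |q|) ^ (-a) * (1 + |q|) ^ (-b) := by
  rw [abs_of_pos hq, neg_add, Real.rpow_add (by linarith),
    show 1 + t + q = 1 + r by rw [hr]; ring]
  refine mul_le_mul_of_nonneg_left ?_ (Real.rpow_nonneg (by linarith) _)
  exact Real.rpow_le_rpow_of_nonpos (by linarith) (by linarith) (by linarith)

/-- Inside the light cone all weights are bounded below, since the cone over the slab is bounded. -/
lemma rpow_neg_two_le {T t r q a b : ℝ} (ht : t ∈ Set.Ico 0 T) (hr0 : 0 ≤ r) (hr : q = r - t)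
    (hq : q < 0) (ha : 0 ≤ a) (ha2 : a ≤ 2) (hab : a - b ≤ 2) :
    (1 + 2 * T) ^ (-2 : ℝ) ≤ (1 + t + |q|) ^ (-a) * (1 + |q|) ^ b := by
  have hT : 0 < T := ht.1.trans_lt ht.2
  have ht1 := ht.1
  have ht2 := ht.2
  rw [abs_of_neg hq]
  have h1 : (1 + 2 * T) ^ (-a) ≤ (1 + t + -q) ^ (-a) :=
    Real.rpow_le_rpow_of_nonpos (by linarith) (by linarith) (by linarith)
  have h2 : (1 + 2 * T) ^ min b 0 ≤ (1 + -q) ^ b := by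
    refine (Real.rpow_le_rpow_of_nonpos (y := 1 + 2 * T) (x := 1 + -q) (by linarith) (by linarith)
      (min_le_right b 0)).trans ?_
    exact Real.rpow_le_rpow_of_exponent_le (by linarith) (min_le_left b 0)
  refine le_trans ?_ (mul_le_mul h1 h2 (by positivity) (Real.rpow_nonneg (by linarith) _))
  rw [← Real.rpow_add (by linarith)]
  refine Real.rpow_le_rpow_of_exponent_le (by linarith) ?_
  rcases le_total b 0 with h | h
  · rw [min_eq_left h]; linarith
  · rw [min_eq_right h]; linarith

/-- On a slab of finite height decay in `1 + |x|` amounts to decay in `1 + t + |q|` and `1 + |q|`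
for `q > 0`, and to boundedness for `q < 0`. -/
lemma le_decay_of_le_rpow {T t r q a b b' B X : ℝ} (ht : t ∈ Set.Ico 0 T) (hr0 : 0 ≤ r)
    (hr : q = r - t) (hB : 0 ≤ B) (ha : 0 ≤ a) (ha2 : a ≤ 2) (hab : a - b' ≤ 2) (hb : 0 ≤ b)
    (hX : X ≤ B * (1 + r) ^ (-(a + b))) :
    (0 < q → X ≤ B * (1 + 2 * T) ^ (2 : ℝ) * (1 + t + |q|) ^ (-a) * (1 + |q|) ^ (-b)) ∧
      (q < 0 → X ≤ B * (1 + 2 * T) ^ (2 : ℝ) * (1 + t + |q|) ^ (-a) * (1 + |q|) ^ b') := by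
  have hT : 0 < T := ht.1.trans_lt ht.2
  have hM : 1 ≤ (1 + 2 * T) ^ (2 : ℝ) := Real.one_le_rpow (by linarith) (by norm_num)
  refine ⟨fun hq => ?_, fun hq => ?_⟩
  · rw [mul_assoc]
    exact hX.trans (mul_le_mul (le_mul_of_one_le_right hB hM) (rpow_neg_add_le ht.1 hq hr hb)
      (by positivity) (by positivity))
  · have h1 : (1 + r) ^ (-(a + b)) ≤ 1 :=
      Real.rpow_le_one_of_one_le_of_nonpos (by linarith) (by linarith)
    have h2 := rpow_neg_two_le ht hr0 hr hq ha ha2 hab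
    rw [mul_assoc, mul_assoc]
    refine hX.trans (mul_le_mul_of_nonneg_left (h1.trans ?_) hB)
    refine le_trans (le_of_eq ?_) (mul_le_mul_of_nonneg_left h2 (zero_le_one.trans hM))
    rw [← Real.rpow_add (by linarith)]
    norm_num

/-! ### Decay of the tensor fields -/

/-- The decay of tensor fields in terms of `1 + |x|`. The factor `320 = (16 + 4) · 4 · 4` in the
constant counts the components of `h` and `A`, the directions `β`, and the terms of `∂̄_β`. -/
theorem exists_tensor_decay {T γ : ℝ} (hT : 0 < T) (hγ : 0 < γ) (μ : ℝ) : ∃ K : ℝ, 0 < K ∧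
    ∀ (m : ℕ) (h : Fin 4 × Fin 4 → Spacetime → ℝ) (A : Fin 4 → Spacetime → ℝ)
      (Jh : Fin 4 × Fin 4 → Jet) (JA : Fin 4 → Jet),
      (∀ c, IsSobolevJet (m + 2) T (h c) (Jh c)) → (∀ c, IsSobolevJet (m + 2) T (A c) (JA c)) →
      (∀ c, Tendsto (fun x : Space => h c (0, x)) (cocompact Space) (𝓝 0)) →
      (∀ c, Tendsto (fun x : Space => A c (0, x)) (cocompact Space) (𝓝 0)) →
      ∀ t ∈ Set.Ico 0 T, ∀ e : ℝ, 0 < e →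
      (∀ τ ∈ Set.Icc 0 t, energy (m + 1) γ μ Jh JA τ ≤ ENNReal.ofReal e) →
      ∀ I : List ZField, I.length + 1 ≤ m → ∀ x : Space,
        normDZ I h (t, x) + normDZ I A (t, x) ≤ K * e * (1 + ‖x‖) ^ (-2 - γ) ∧
        normZ I h (t, x) + normZ I A (t, x) ≤ K * e * (1 + ‖x‖) ^ (-1 - γ) ∧
        normTangZ I h (t, x) + normTangZ I A (t, x) ≤ K * e * (1 + ‖x‖) ^ (-2 - γ) := by
  obtain ⟨K, hK, hdecay⟩ := exists_component_decay hT hγ μ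
  refine ⟨320 * K, by positivity, ?_⟩
  intro m h A Jh JA hh hA hh0 hA0 t ht e he hE I hI x
  have hhd := fun c => hdecay m (h c) (Jh c) (hh c) (hh0 c) t ht e he (fun τ hτ L hL β =>
    (eLpNorm_le_energyTerm γ μ L Jh τ c β).trans (le_self_add.trans
      ((energyTerm_add_le_energy γ μ Jh JA τ hL).trans (hE τ hτ)))) I hI x
  have hAd := fun c => hdecay m (A c) (JA c) (hA c) (hA0 c) t ht e he (fun τ hτ L hL β =>
    (eLpNorm_le_energyTerm γ μ L JA τ c β).trans (le_add_self.trans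
      ((energyTerm_add_le_energy γ μ Jh JA τ hL).trans (hE τ hτ)))) I hI x
  have hB2 : 0 ≤ K * e * (1 + ‖x‖) ^ (-2 - γ) := by positivity
  have hB1 : 0 ≤ K * e * (1 + ‖x‖) ^ (-1 - γ) := by positivity
  have e2 : 320 * K * e * (1 + ‖x‖) ^ (-2 - γ) = 320 * (K * e * (1 + ‖x‖) ^ (-2 - γ)) := by ring
  have e1 : 320 * K * e * (1 + ‖x‖) ^ (-1 - γ) = 320 * (K * e * (1 + ‖x‖) ^ (-1 - γ)) := by ring
  rw [e1, e2]
  have n1 := sqrt_sum_sum_sq_le hB2 fun c α => (hhd c).1 α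
  have n2 := sqrt_sum_sum_sq_le hB2 fun c α => (hAd c).1 α
  have n3 := sqrt_sum_sq_le hB1 fun c => (hhd c).2
  have n4 := sqrt_sum_sq_le hB1 fun c => (hAd c).2
  have n5 := sqrt_sum_sum_sq_le (by positivity) fun c β => abs_tang_le (hhd c).1 β
  have n6 := sqrt_sum_sum_sq_le (by positivity) fun c β => abs_tang_le (hAd c).1 β
  simp only [Fintype.card_prod, Fintype.card_fin, Nat.cast_mul, Nat.cast_ofNat] at n1 n2 n3 n4 n5 n6
  refine ⟨?_, ?_, ?_⟩
  · refine (add_le_add n1 n2).trans ?_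
    linarith
  · refine (add_le_add n3 n4).trans ?_
    linarith
  · refine (add_le_add n5 n6).trans ?_
    linarith

end EinsteinMaxwell

theorem theorem5p1 (N : ℕ) (hN : 4 ≤ N) (γ μ : ℝ) (hγ : γ ∈ Set.Ioo (0 : ℝ) (1 / 2))
    (hμ : μ ∈ Set.Ioo (0 : ℝ) (1 / 2)) (T : ℝ) (hT : 0 < T) (C : ℝ) (hC : 0 < C) :
    ∃ K : ℝ, 0 < K ∧ ∀ (ε : ℝ), 0 < ε → ∀ (T₀ : ℝ), T₀ ≤ T →
      ∀ (h : Fin 4 × Fin 4 → Spacetime → ℝ) (A : Fin 4 → Spacetime → ℝ)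
        (Jh : Fin 4 × Fin 4 → Jet) (JA : Fin 4 → Jet),
      -- `h` and `A` lie in the solution space, with generalized derivatives `Jh` and `JA`
      (∀ c, IsSobolevJet (N + 1) T (h c) (Jh c)) →
      (∀ c, IsSobolevJet (N + 1) T (A c) (JA c)) →
      -- the initial values vanish at spatial infinity
      (∀ c, Tendsto (fun x : Space => h c (0, x)) (cocompact Space) (𝓝 0)) →
      (∀ c, Tendsto (fun x : Space => A c (0, x)) (cocompact Space) (𝓝 0)) →
      -- the bootstrap bound
      (∀ t ∈ Set.Ico 0 T₀, energy N γ μ Jh JA t ≤ ENNReal.ofReal (2 * C * ε)) →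
      -- the classical derivatives below exist
      ((∀ c, ContDiffOn ℝ ((N - 1 : ℕ) : WithTop ℕ∞) (h c) (slab T)) ∧
        (∀ c, ContDiffOn ℝ ((N - 1 : ℕ) : WithTop ℕ∞) (A c) (slab T))) ∧
      ∀ t ∈ Set.Ico 0 T₀, ∀ x : Space, ∀ q : ℝ, q = qvar (t, x) →
        -- decay in `t` and `q`
        ((∀ I : List ZField, I.length ≤ N - 3 →
            (0 < q → normDZ I h (t, x) + normDZ I A (t, x)
              ≤ K * ε * (1 + t + |q|) ^ (-1 : ℝ) * (1 + |q|) ^ (-1 - γ)) ∧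
            (q < 0 → normDZ I h (t, x) + normDZ I A (t, x)
              ≤ K * ε * (1 + t + |q|) ^ (-1 : ℝ) * (1 + |q|) ^ (-1 / 2 : ℝ))) ∧
          (∀ I : List ZField, I.length ≤ N - 3 →
            (0 < q → normZ I h (t, x) + normZ I A (t, x)
              ≤ K * ε * (1 + t + |q|) ^ (-1 : ℝ) * (1 + |q|) ^ (-γ)) ∧
            (q < 0 → normZ I h (t, x) + normZ I A (t, x)
              ≤ K * ε * (1 + t + |q|) ^ (-1 : ℝ) * (1 + |q|) ^ (1 / 2 : ℝ))) ∧
          (∀ I : List ZField, I.length ≤ N - 4 → x ≠ 0 →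
            (0 < q → normTangZ I h (t, x) + normTangZ I A (t, x)
              ≤ K * ε * (1 + t + |q|) ^ (-2 : ℝ) * (1 + |q|) ^ (-γ)) ∧
            (q < 0 → normTangZ I h (t, x) + normTangZ I A (t, x)
              ≤ K * ε * (1 + t + |q|) ^ (-2 : ℝ) * (1 + |q|) ^ (1 / 2 : ℝ)))) ∧
        -- the restated form, with decay in `q` only
        ((∀ I : List ZField, I.length ≤ N - 3 →
            (0 < q → normDZ I h (t, x) + normDZ I A (t, x)
              ≤ K * ε * (1 + |q|) ^ (-2 - γ)) ∧
            (q < 0 → normDZ I h (t, x) + normDZ I A (t, x)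
              ≤ K * ε * (1 + |q|) ^ (-3 / 2 : ℝ))) ∧
          (∀ I : List ZField, I.length ≤ N - 3 →
            (0 < q → normZ I h (t, x) + normZ I A (t, x)
              ≤ K * ε * (1 + |q|) ^ (-1 - γ)) ∧
            (q < 0 → normZ I h (t, x) + normZ I A (t, x)
              ≤ K * ε * (1 + |q|) ^ (-1 / 2 : ℝ))) ∧
          (∀ I : List ZField, I.length ≤ N - 4 → x ≠ 0 →
            (0 < q → normTangZ I h (t, x) + normTangZ I A (t, x)
              ≤ K * ε * (1 + |q|) ^ (-2 - γ)) ∧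
            (q < 0 → normTangZ I h (t, x) + normTangZ I A (t, x)
              ≤ K * ε * (1 + |q|) ^ (-3 / 2 : ℝ)))) := by
  obtain ⟨K, hK, hdecay⟩ := exists_tensor_decay hT hγ.1 μ
  refine ⟨K * (2 * C) * (1 + 2 * T) ^ (2 : ℝ), by positivity, ?_⟩
  intro ε hε T₀ hT₀ h A Jh JA hh hA hh0 hA0 hE
  obtain ⟨m, rfl⟩ : ∃ m, N = m + 1 := ⟨N - 1, by omega⟩
  refine ⟨⟨fun c => ?_, fun c => ?_⟩, fun t ht x q hq => ?_⟩
  · obtain ⟨V, hV0, hV, -⟩ := (hh c).exists_isClassicalJet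
    exact hV0 ▸ hV.contDiffOn (by simp)
  · obtain ⟨V, hV0, hV, -⟩ := (hA c).exists_isClassicalJet
    exact hV0 ▸ hV.contDiffOn (by simp)
  have htT : t ∈ Set.Ico 0 T := ⟨ht.1, ht.2.trans_le hT₀⟩
  have hb := fun I hI => hdecay m h A Jh JA hh hA hh0 hA0 t htT (2 * C * ε) (by positivity)
    (fun τ hτ => hE τ ⟨hτ.1, hτ.2.trans_lt ht.2⟩) I hI x
  have hγ0 := hγ.1
  have eK : K * (2 * C) * (1 + 2 * T) ^ (2 : ℝ) * ε
      = K * (2 * C * ε) * (1 + 2 * T) ^ (2 : ℝ) := by ring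
  have hB : 0 ≤ K * (2 * C * ε) := by positivity
  have key : ∀ (a b b' X : ℝ), 0 ≤ a → a ≤ 2 → a - b' ≤ 2 → 0 ≤ b →
      X ≤ K * (2 * C * ε) * (1 + ‖x‖) ^ (-(a + b)) →
      (0 < q → X ≤ K * (2 * C * ε) * (1 + 2 * T) ^ (2 : ℝ) * (1 + t + |q|) ^ (-a)
        * (1 + |q|) ^ (-b)) ∧
      (q < 0 → X ≤ K * (2 * C * ε) * (1 + 2 * T) ^ (2 : ℝ) * (1 + t + |q|) ^ (-a)
        * (1 + |q|) ^ b') := fun a b b' X ha ha2 hab hb hX =>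
    le_decay_of_le_rpow htT (norm_nonneg x) hq hB ha ha2 hab hb hX
  simp only [eK]
  -- the splittings of the rate in `1 + |x|` between `1 + t + |q|` and `1 + |q|`
  have x1 : -2 - γ = -(1 + (1 + γ)) := by ring
  have x2 : -1 - γ = -(1 + γ) := by ring
  have x3 : -2 - γ = -(2 + γ) := by ring
  have x4 : -2 - γ = -(0 + (2 + γ)) := by ring
  have x5 : -1 - γ = -(0 + (1 + γ)) := by ring
  refine ⟨⟨fun I hI => ?_, fun I hI => ?_, fun I hI _ => ?_⟩,
    fun I hI => ?_, fun I hI => ?_, fun I hI _ => ?_⟩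
  · rw [x2]
    exact key 1 (1 + γ) (-1 / 2) _ (by norm_num) (by norm_num) (by norm_num) (by linarith)
      (x1 ▸ (hb I (by omega)).1)
  · exact key 1 γ (1 / 2) _ (by norm_num) (by norm_num) (by norm_num) hγ0.le
      (x2 ▸ (hb I (by omega)).2.1)
  · exact key 2 γ (1 / 2) _ (by norm_num) (by norm_num) (by norm_num) hγ0.le
      (x3 ▸ (hb I (by omega)).2.2)
  · have := key 0 (2 + γ) (-3 / 2) _ (by norm_num) (by norm_num) (by norm_num) (by linarith)
      (x4 ▸ (hb I (by omega)).1)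
    rw [x3]
    simpa only [neg_zero, Real.rpow_zero, mul_one] using this
  · have := key 0 (1 + γ) (-1 / 2) _ (by norm_num) (by norm_num) (by norm_num) (by linarith)
      (x5 ▸ (hb I (by omega)).2.1)
    rw [x2]
    simpa only [neg_zero, Real.rpow_zero, mul_one] using this
  · have := key 0 (2 + γ) (-3 / 2) _ (by norm_num) (by norm_num) (by norm_num) (by linarith)
      (x4 ▸ (hb I (by omega)).2.2)
    rw [x3]
    simpa only [neg_zero, Real.rpow_zero, mul_one] using this
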